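/- Let $k$ be an algebraically closed field of characteristic zero, let $q\in k^\times$ with $q\neq\pm1$, and let $N,m\ge 3$. Let $n\ge 1$ with $m\mid n$, and let $\lambda\in k$ be a primitive $m$-th root of unity. Let $T_n(\lambda,m,0)$ be the generalized Taft algebra: the Hopf algebra generated by $g,x$ with relations $g^n=1$, $x^m=0$, $gx=\lambda xg$, where $\Delta(g)=g\otimes g$, $\Delta(x)=g\otimes x+x\otimes 1$, $\varepsilon(g)=1$, $\varepsilon(x)=0$. Let $\mathcal O_q(M_N(k))$ be the $k$-algebra generated by $Y_{ij}$, $1\le i,j\le N$, with relations $$Y_{ij}Y_{\ell r}=\begin{cases} qY_{\ell r}Y_{ij} & (i<\ell,\ j=r)\text{ or }(i=\ell,\ j<r),\\ Y_{\ell r}Y_{ij} & (i<\ell,\ j>r),\\ Y_{\ell r}Y_{ij}+(q-q^{-1})Y_{ir}Y_{\ell j} & (i<\ell,\ j<r).\end{cases}$$ Let $\mathcal H$ be the group of automorphisms $Y_{ij}\mapsto a_ib_jY_{ij}$ with all $a_i,b_j\in k^\times$, and let $\tau$ be the automorphism $Y_{ij}\mapsto Y_{ji}$. An action of a Hopf algebra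 $H$ on an algebra $A$ is a left $H$-module algebra structure on $A$, i.e. a left $H$-module structure with $h\cdot 1=\varepsilon(h)1$ and $h\cdot(ab)=\sum(h_1\cdot a)(h_2\cdot b)$. Call an action of $T_n(\lambda,m,0)$ on $\mathcal O_q(M_N(k))$ admissible if $x$ maps the span of the $Y_{ij}$ into itself, $x$ does not act as zero, and $g$ acts as an element of $\mathcal H\rtimes\langle\tau\rangle$. Then an admissible action exists if and only if $\lambda=q^{2}$ or $\lambda=q^{-2}$, and $\operatorname{ord}(q)$ is finite and divides $n$. Moreover, the admissible actions are exactly those which, for some $\delta\in k^\times$, are given on generators by $g\cdot Y_{ij}=\alpha_{ij}Y_{ij}$ and $x$ as in one of the following eight families ($x\cdot Y_{ij}=0$ if not listed): 1. $\lambda=q^2$, $1<b\le N$: $\alpha_{i,b-1}=q$, $\alpha_{ib}=q^{-1}$, all other $\alpha_{ij}=1$; $x\cdot Y_{ib}=\delta Y_{i,b-1}$ for all $i$. 2. $\lambda=q^2$, $1<a\le N$: $\alpha_{a-1,j}=q$, $\alpha_{aj}=q^{-1}$, all other $\alpha_{ij}=1$; $x\cdot Y_{aj}=\delta Y_{a-1,j}$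 for all $j$. 3. $\lambda=q^2$: $\alpha_{ij}=r_ic_j$ with $r_1=q^{-2}$, $r_i=1$ for $i>1$, $c_1=q^{-1}$, $c_N=q$, $c_j=1$ for $1<j<N$; $x\cdot Y_{11}=\delta Y_{1N}$. 4. $\lambda=q^2$: $\alpha_{ij}=c_ir_j$ with $r,c$ as in 3; $x\cdot Y_{11}=\delta Y_{N1}$. 5. $\lambda=q^{-2}$, $1\le b<N$: $\alpha_{ib}=q$, $\alpha_{i,b+1}=q^{-1}$, all other $\alpha_{ij}=1$; $x\cdot Y_{ib}=\delta Y_{i,b+1}$ for all $i$. 6. $\lambda=q^{-2}$, $1\le a<N$: $\alpha_{aj}=q$, $\alpha_{a+1,j}=q^{-1}$, all other $\alpha_{ij}=1$; $x\cdot Y_{aj}=\delta Y_{a+1,j}$ for all $j$. 7. $\lambda=q^{-2}$: $\alpha_{ij}=c_is_j$ with $c$ as in 3, $s_N=q^{2}$, $s_j=1$ for $j<N$; $x\cdot Y_{NN}=\delta Y_{1N}$. 8. $\lambda=q^{-2}$: $\alpha_{ij}=s_ic_j$ with $s,c$ as in 7; $x\cdot Y_{NN}=\delta Y_{N1}$.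 If $\operatorname{ord}(q)\mid n$, then for every family with matching $\lambda$, every value of its parameter and every $\delta\in k^\times$, there is exactly one action with these values on the generators. -/

import Mathlib

open scoped TensorProduct

noncomputable section

universe u

namespace QuantumMatrixActions

/-! ### Gaussian binomials and the power of a sum of skew-commuting elements -/

/-- Gaussian binomial coefficients at `lam`. -/
def gaussBinom {k : Type u} [Field k] (lam : k) : ℕ → ℕ → k
  | _, 0 => 1
  | 0, _ + 1 => 0
  | r + 1, s + 1 => gaussBinom lam r s + lam ^ (s + 1) * gaussBinom lam r (s + 1)

theorem gaussBinom_zero_right {k : Type u} [Field k] (lam : k) (r : ℕ) :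
    gaussBinom lam r 0 = 1 := by
  cases r <;> rfl

theorem gaussBinom_eq_zero_of_lt {k : Type u} [Field k] (lam : k) :
    ∀ r s : ℕ, r < s → gaussBinom lam r s = 0
  | 0, s + 1, _ => rfl
  | r + 1, s + 1, h => by
    simp [gaussBinom, gaussBinom_eq_zero_of_lt lam r s (by omega),
      gaussBinom_eq_zero_of_lt lam r (s + 1) (by omega)]

theorem gaussBinom_rec {k : Type u} [Field k] (lam : k) : ∀ r s : ℕ,
    lam ^ s * (lam ^ (s + 1) - 1) * gaussBinom lam r (s + 1)
      = (lam ^ r - lam ^ s) * gaussBinom lam r s := by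
  intro r
  induction r with
  | zero =>
    intro s
    cases s with
    | zero => simp [gaussBinom]
    | succ s => simp [gaussBinom]
  | succ r ih =>
    intro s
    cases s with
    | zero =>
      have h := ih 0
      simp only [gaussBinom, gaussBinom_zero_right] at h ⊢
      linear_combination lam * h
    | succ s =>
      have h := ih s
      have h' := ih (s + 1)
      simp only [gaussBinom]
      linear_combination (lam ^ (s + 2)) * h' + lam * h

theorem gaussBinom_primitive {k : Type u} [Field k] {lam : k} {m : ℕ}
    (h : IsPrimitiveRoot lam m) : ∀ s : ℕ, s + 1 < m → gaussBinom lam m (s + 1) = 0 := by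
  intro s
  induction s with
  | zero =>
    intro hs
    have h0 := gaussBinom_rec lam m 0
    have h1 : lam - 1 ≠ 0 := by
      have := h.pow_ne_one_of_pos_of_lt (l := 1) (by omega) (by omega)
      simpa [sub_ne_zero] using this
    simpa [h.pow_eq_one, h1] using h0
  | succ s ih =>
    intro hs
    have h0 := gaussBinom_rec lam m (s + 1)
    rw [ih (by omega), mul_zero] at h0
    have h1 : lam ^ (s + 1 + 1) - 1 ≠ 0 :=
      sub_ne_zero.mpr (h.pow_ne_one_of_pos_of_lt (by omega) (by omega))
    have h2 : lam ^ (s + 1) ≠ 0 := pow_ne_zero _ (h.ne_zero (by omega))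
    simpa [h1, h2] using h0

theorem skew_pow_mul {k : Type u} [Field k] {R : Type*} [Ring R] [Algebra k R] (lam : k) {a b : R}
    (hab : b * a = lam • (a * b)) (s : ℕ) : b * a ^ s = lam ^ s • (a ^ s * b) := by
  induction s with
  | zero => simp
  | succ s ih =>
    rw [pow_succ, ← mul_assoc, ih, smul_mul_assoc, mul_assoc, hab, mul_smul_comm, smul_smul,
      mul_assoc, pow_succ]

theorem skew_add_pow {k : Type u} [Field k] {R : Type*} [Ring R] [Algebra k R] (lam : k) {a b : R}
    (hab : b * a = lam • (a * b)) (r : ℕ) :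
    (a + b) ^ r = ∑ s ∈ Finset.range (r + 1), gaussBinom lam r s • (a ^ s * b ^ (r - s)) := by
  induction r with
  | zero => simp [gaussBinom]
  | succ r ih =>
    rw [pow_succ', ih, add_mul, Finset.mul_sum, Finset.mul_sum,
      Finset.sum_range_succ' _ (r + 1)]
    have e1 : ∀ s ∈ Finset.range (r + 1),
        b * gaussBinom lam r s • (a ^ s * b ^ (r - s))
          = (lam ^ s * gaussBinom lam r s) • (a ^ s * b ^ (r + 1 - s)) := by
      intro s hs
      have hs' : r + 1 - s = (r - s) + 1 := by
        have := Finset.mem_range.mp hs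
        omega
      rw [mul_smul_comm, ← mul_assoc, skew_pow_mul lam hab, smul_mul_assoc, smul_smul, mul_assoc,
        ← pow_succ', hs', mul_comm]
    rw [Finset.sum_congr rfl e1]
    have e2 : ∑ s ∈ Finset.range (r + 1),
        (lam ^ s * gaussBinom lam r s) • (a ^ s * b ^ (r + 1 - s))
        = ∑ s ∈ Finset.range (r + 1 + 1),
        (lam ^ s * gaussBinom lam r s) • (a ^ s * b ^ (r + 1 - s)) := by
      rw [Finset.sum_range_succ _ (r + 1), gaussBinom_eq_zero_of_lt lam r (r + 1) (by omega)]
      simp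
    rw [e2, Finset.sum_range_succ' _ (r + 1), ← add_assoc, ← Finset.sum_add_distrib]
    congr 1
    · refine Finset.sum_congr rfl fun s _ => ?_
      have : r + 1 - (s + 1) = r - s := by omega
      rw [this, mul_smul_comm, ← mul_assoc, ← pow_succ', ← add_smul]
      rfl
    · simp [gaussBinom_zero_right]

theorem skew_add_pow_eq_zero {k : Type u} [Field k] {R : Type*} [Ring R] [Algebra k R] {lam : k}
    {m : ℕ} (hlam : IsPrimitiveRoot lam m) {a b : R} (hab : b * a = lam • (a * b))
    (ha : a ^ m = 0) (hb : b ^ m = 0) : (a + b) ^ m = 0 := by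
  rw [skew_add_pow lam hab]
  refine Finset.sum_eq_zero fun s hs => ?_
  have hs' := Finset.mem_range.mp hs
  rcases Nat.eq_zero_or_pos s with rfl | h0
  · simp [hb]
  · rcases Nat.lt_or_ge s m with h1 | h1
    · obtain ⟨t, rfl⟩ : ∃ t, s = t + 1 := ⟨s - 1, by omega⟩
      rw [gaussBinom_primitive hlam t h1, zero_smul]
    · obtain rfl : s = m := by omega
      simp [ha]

/-! ### The generalized Taft algebra `T_n(lam, m, 0)` -/

/-- The two generators of a generalized Taft algebra. -/
inductive TaftGen : Type
  | g : TaftGen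
  | x : TaftGen

/-- The defining relations `g ^ n = 1`, `x ^ m = 0`, `g x = lam x g`. -/
inductive TaftRel (k : Type u) [Field k] (n m : ℕ) (lam : k) :
    FreeAlgebra k TaftGen → FreeAlgebra k TaftGen → Prop
  | g_pow : TaftRel k n m lam (FreeAlgebra.ι k TaftGen.g ^ n) 1
  | x_pow : TaftRel k n m lam (FreeAlgebra.ι k TaftGen.x ^ m) 0
  | skew : TaftRel k n m lam (FreeAlgebra.ι k TaftGen.g * FreeAlgebra.ι k TaftGen.x)
      (lam • (FreeAlgebra.ι k TaftGen.x * FreeAlgebra.ι k TaftGen.g))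

/-- The algebra `T_n(lam, m, 0)`. -/
def Taft (k : Type u) [Field k] (n m : ℕ) (lam : k) : Type u := RingQuot (TaftRel k n m lam)

namespace Taft

instance instRing (k : Type u) [Field k] (n m : ℕ) (lam : k) : Ring (Taft k n m lam) :=
  inferInstanceAs (Ring (RingQuot (TaftRel k n m lam)))

instance instAlgebra (k : Type u) [Field k] (n m : ℕ) (lam : k) : Algebra k (Taft k n m lam) :=
  inferInstanceAs (Algebra k (RingQuot (TaftRel k n m lam)))

/-- The quotient map from the free algebra. -/
def mk (k : Type u) [Field k] (n m : ℕ) (lam : k) :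
    FreeAlgebra k TaftGen →ₐ[k] Taft k n m lam :=
  RingQuot.mkAlgHom k (TaftRel k n m lam)

/-- The generator `g`. -/
def g (k : Type u) [Field k] (n m : ℕ) (lam : k) : Taft k n m lam :=
  mk k n m lam (FreeAlgebra.ι k TaftGen.g)

/-- The generator `x`. -/
def x (k : Type u) [Field k] (n m : ℕ) (lam : k) : Taft k n m lam :=
  mk k n m lam (FreeAlgebra.ι k TaftGen.x)

section

variable {k : Type u} [Field k] {n m : ℕ} {lam : k}

theorem g_pow : g k n m lam ^ n = 1 := by
  have := RingQuot.mkAlgHom_rel k (TaftRel.g_pow (k := k) (n := n) (m := m) (lam := lam))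
  rw [map_pow, map_one] at this
  exact this

theorem x_pow : x k n m lam ^ m = 0 := by
  have := RingQuot.mkAlgHom_rel k (TaftRel.x_pow (k := k) (n := n) (m := m) (lam := lam))
  rw [map_pow, map_zero] at this
  exact this

theorem g_mul_x : g k n m lam * x k n m lam = lam • (x k n m lam * g k n m lam) := by
  have := RingQuot.mkAlgHom_rel k (TaftRel.skew (k := k) (n := n) (m := m) (lam := lam))
  rw [map_mul, map_smul, map_mul] at this
  exact this

/-- The universal property of the presentation. -/
def lift {B : Type*} [Ring B] [Algebra k B] (G X : B) (h1 : G ^ n = 1) (h2 : X ^ m = 0)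
    (h3 : G * X = lam • (X * G)) : Taft k n m lam →ₐ[k] B :=
  RingQuot.liftAlgHom k ⟨FreeAlgebra.lift k (fun i => TaftGen.rec G X i), by
    intro a b hab
    cases hab <;> simp [h1, h2, h3]⟩

theorem lift_g {B : Type*} [Ring B] [Algebra k B] (G X : B) (h1 : G ^ n = 1) (h2 : X ^ m = 0)
    (h3 : G * X = lam • (X * G)) : lift G X h1 h2 h3 (g k n m lam) = G := by
  refine (RingQuot.liftAlgHom_mkAlgHom_apply (S := k) _ _ _).trans ?_
  simp

theorem lift_x {B : Type*} [Ring B] [Algebra k B] (G X : B) (h1 : G ^ n = 1) (h2 : X ^ m = 0)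
    (h3 : G * X = lam • (X * G)) : lift G X h1 h2 h3 (x k n m lam) = X := by
  refine (RingQuot.liftAlgHom_mkAlgHom_apply (S := k) _ _ _).trans ?_
  simp

theorem induction {P : Taft k n m lam → Prop} (halg : ∀ c : k, P (algebraMap k _ c))
    (hg : P (g k n m lam)) (hx : P (x k n m lam)) (hmul : ∀ a b, P a → P b → P (a * b))
    (hadd : ∀ a b, P a → P b → P (a + b)) (a : Taft k n m lam) : P a := by
  obtain ⟨w, rfl⟩ : ∃ w, mk k n m lam w = a :=
    RingQuot.mkAlgHom_surjective k (TaftRel k n m lam) a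
  induction w using FreeAlgebra.induction with
  | grade0 c => simpa using halg c
  | grade1 i => cases i <;> assumption
  | mul a b ha hb => simpa using hmul _ _ ha hb
  | add a b ha hb => simpa using hadd _ _ ha hb

theorem algHom_ext {B : Type*} [Semiring B] [Algebra k B] {f f' : Taft k n m lam →ₐ[k] B}
    (hg : f (g k n m lam) = f' (g k n m lam)) (hx : f (x k n m lam) = f' (x k n m lam)) :
    f = f' := by
  ext a
  induction a using Taft.induction with
  | halg c => simp
  | hg => exact hg
  | hx => exact hx
  | hmul a b ha hb => simp [ha, hb]
  | hadd a b ha hb => simp [ha, hb]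

/-- The comultiplication, with `g` grouplike and `x ↦ g ⊗ x + x ⊗ 1`. -/
def comulHom (hlam : IsPrimitiveRoot lam m) :
    Taft k n m lam →ₐ[k] Taft k n m lam ⊗[k] Taft k n m lam :=
  lift (g k n m lam ⊗ₜ g k n m lam) (x k n m lam ⊗ₜ 1 + g k n m lam ⊗ₜ x k n m lam)
    (by rw [Algebra.TensorProduct.tmul_pow, g_pow]; rfl)
    (by
      refine skew_add_pow_eq_zero hlam ?_ ?_ ?_
      · rw [Algebra.TensorProduct.tmul_mul_tmul, Algebra.TensorProduct.tmul_mul_tmul, g_mul_x,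
          one_mul, mul_one, TensorProduct.smul_tmul']
      · rw [Algebra.TensorProduct.tmul_pow, x_pow, TensorProduct.zero_tmul]
      · rw [Algebra.TensorProduct.tmul_pow, x_pow, TensorProduct.tmul_zero])
    (by
      simp only [mul_add, add_mul, Algebra.TensorProduct.tmul_mul_tmul, g_mul_x, one_mul, mul_one,
        smul_add, TensorProduct.smul_tmul', TensorProduct.tmul_smul])

/-- The counit, with `g ↦ 1` and `x ↦ 0`. -/
def counitHom (hm : m ≠ 0) : Taft k n m lam →ₐ[k] k :=
  lift 1 0 (one_pow n) (zero_pow hm) (by simp)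

theorem g_mul_pow_pred (hn : n ≠ 0) : g k n m lam * g k n m lam ^ (n - 1) = 1 := by
  rw [← pow_succ', Nat.sub_add_cancel (Nat.pos_of_ne_zero hn), g_pow]

theorem pow_pred_mul_g (hn : n ≠ 0) : g k n m lam ^ (n - 1) * g k n m lam = 1 := by
  rw [← pow_succ, Nat.sub_add_cancel (Nat.pos_of_ne_zero hn), g_pow]

theorem x_mul_pow_pred (hn : n ≠ 0) : x k n m lam * g k n m lam ^ (n - 1)
    = lam • (g k n m lam ^ (n - 1) * x k n m lam) := by
  calc x k n m lam * g k n m lam ^ (n - 1)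
      = g k n m lam ^ (n - 1) * (g k n m lam * x k n m lam) * g k n m lam ^ (n - 1) := by
        rw [← mul_assoc, pow_pred_mul_g hn, one_mul]
    _ = lam • (g k n m lam ^ (n - 1) * x k n m lam) := by
        rw [g_mul_x, mul_smul_comm, smul_mul_assoc, mul_assoc, mul_assoc, g_mul_pow_pred hn,
          mul_one]

theorem pow_pred_mul_x_pow (hn : n ≠ 0) : (g k n m lam ^ (n - 1) * x k n m lam) ^ m = 0 := by
  have key : ∀ r : ℕ, ∃ c : k, (g k n m lam ^ (n - 1) * x k n m lam) ^ r
      = c • ((g k n m lam ^ (n - 1)) ^ r * x k n m lam ^ r) := by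
    intro r
    induction r with
    | zero => exact ⟨1, by simp⟩
    | succ r ih =>
      obtain ⟨c, hcr⟩ := ih
      have h1 : ∀ s : ℕ, x k n m lam ^ s * g k n m lam ^ (n - 1)
          = lam ^ s • (g k n m lam ^ (n - 1) * x k n m lam ^ s) := by
        intro s
        induction s with
        | zero => simp
        | succ s ihs =>
          rw [pow_succ, mul_assoc, x_mul_pow_pred hn, mul_smul_comm, ← mul_assoc, ihs,
            smul_mul_assoc, smul_smul, mul_assoc, pow_succ lam, mul_comm lam]
      refine ⟨c * lam ^ r, ?_⟩
      rw [pow_succ, hcr, smul_mul_assoc, mul_assoc, ← mul_assoc (x k n m lam ^ r), h1 r,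
        smul_mul_assoc, mul_smul_comm, smul_smul, pow_succ, pow_succ]
      simp only [mul_assoc]
  obtain ⟨c, hcm⟩ := key m
  rw [hcm, x_pow, mul_zero, smul_zero]

/-- The antipode as an algebra map to the opposite algebra, with `g ↦ g⁻¹ = g ^ (n - 1)` and
`x ↦ - g⁻¹ x`. -/
def antipodeHom (hn : n ≠ 0) : Taft k n m lam →ₐ[k] (Taft k n m lam)ᵐᵒᵖ :=
  lift (MulOpposite.op (g k n m lam ^ (n - 1)))
    (MulOpposite.op (-(g k n m lam ^ (n - 1) * x k n m lam)))
    (by rw [← MulOpposite.op_pow, ← pow_mul, mul_comm, pow_mul, g_pow, one_pow]; rfl)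
    (by rw [← MulOpposite.op_pow, neg_pow, pow_pred_mul_x_pow hn, mul_zero]; rfl)
    (by
      rw [← MulOpposite.op_mul, ← MulOpposite.op_mul, ← MulOpposite.op_smul, neg_mul, mul_neg,
        mul_assoc, x_mul_pow_pred hn, mul_smul_comm, smul_neg])

theorem comulHom_g (hlam : IsPrimitiveRoot lam m) :
    comulHom (n := n) hlam (g k n m lam) = g k n m lam ⊗ₜ g k n m lam := lift_g ..

theorem comulHom_x (hlam : IsPrimitiveRoot lam m) :
    comulHom (n := n) hlam (x k n m lam)
      = x k n m lam ⊗ₜ 1 + g k n m lam ⊗ₜ x k n m lam := lift_x ..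

theorem counitHom_g (hm : m ≠ 0) : counitHom (n := n) (lam := lam) hm (g k n m lam) = 1 :=
  lift_g ..

theorem counitHom_x (hm : m ≠ 0) : counitHom (n := n) (lam := lam) hm (x k n m lam) = 0 :=
  lift_x ..

theorem antipodeHom_g (hn : n ≠ 0) : antipodeHom (m := m) (lam := lam) hn (g k n m lam)
    = MulOpposite.op (g k n m lam ^ (n - 1)) := lift_g ..

theorem antipodeHom_x (hn : n ≠ 0) : antipodeHom (m := m) (lam := lam) hn (x k n m lam)
    = MulOpposite.op (-(g k n m lam ^ (n - 1) * x k n m lam)) := lift_x ..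

/-- The antipode as a linear map. -/
def antipodeMap (hn : n ≠ 0) : Taft k n m lam →ₗ[k] Taft k n m lam :=
  (MulOpposite.opLinearEquiv k).symm.toLinearMap ∘ₗ (antipodeHom hn).toLinearMap

theorem antipodeMap_apply (hn : n ≠ 0) (a : Taft k n m lam) :
    antipodeMap hn a = (antipodeHom hn a).unop := rfl

theorem antipodeMap_mul (hn : n ≠ 0) (a b : Taft k n m lam) :
    antipodeMap hn (a * b) = antipodeMap hn b * antipodeMap hn a := by
  simp [antipodeMap_apply]

end

/-- The bialgebra structure of `T_n(lam, m, 0)`. -/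
instance instBialgebra (k : Type u) [Field k] (n m : ℕ) (lam : k) [NeZero m]
    [hlam : Fact (IsPrimitiveRoot lam m)] : Bialgebra k (Taft k n m lam) :=
  Bialgebra.ofAlgHom (comulHom hlam.out) (counitHom (NeZero.ne m))
    (by
      apply algHom_ext <;>
        simp [comulHom_g, comulHom_x, TensorProduct.add_tmul, TensorProduct.tmul_add, add_assoc,
          Algebra.TensorProduct.one_def])
    (by
      apply algHom_ext <;>
        simp [comulHom_g, comulHom_x, counitHom_g, counitHom_x])
    (by
      apply algHom_ext <;>
        simp [comulHom_g, comulHom_x, counitHom_g, counitHom_x])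

theorem comul_g (k : Type u) [Field k] (n m : ℕ) (lam : k) [NeZero m]
    [Fact (IsPrimitiveRoot lam m)] :
    Coalgebra.comul (R := k) (g k n m lam) = g k n m lam ⊗ₜ[k] g k n m lam := comulHom_g _

theorem comul_x (k : Type u) [Field k] (n m : ℕ) (lam : k) [NeZero m]
    [Fact (IsPrimitiveRoot lam m)] :
    Coalgebra.comul (R := k) (x k n m lam)
      = x k n m lam ⊗ₜ[k] 1 + g k n m lam ⊗ₜ[k] x k n m lam := comulHom_x _

theorem counit_g (k : Type u) [Field k] (n m : ℕ) (lam : k) [NeZero m]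
    [Fact (IsPrimitiveRoot lam m)] : Coalgebra.counit (R := k) (g k n m lam) = 1 := counitHom_g _

theorem counit_x (k : Type u) [Field k] (n m : ℕ) (lam : k) [NeZero m]
    [Fact (IsPrimitiveRoot lam m)] : Coalgebra.counit (R := k) (x k n m lam) = 0 := counitHom_x _

/-- The Hopf algebra structure of `T_n(lam, m, 0)`. -/
instance instHopfAlgebra (k : Type u) [Field k] (n m : ℕ) (lam : k) [NeZero n] [NeZero m]
    [hlam : Fact (IsPrimitiveRoot lam m)] : HopfAlgebra k (Taft k n m lam) where
  antipode := antipodeMap (NeZero.ne n)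
  mul_antipode_rTensor_comul := by
    have key : ∀ u : Taft k n m lam ⊗[k] Taft k n m lam, ∀ b c : Taft k n m lam,
        LinearMap.mul' k _ ((antipodeMap (NeZero.ne n)).rTensor _ (u * b ⊗ₜ c))
          = antipodeMap (NeZero.ne n) b
            * LinearMap.mul' k _ ((antipodeMap (NeZero.ne n)).rTensor _ u) * c := by
      intro u b c
      induction u with
      | zero => simp
      | tmul a d => simp [antipodeMap_mul, mul_assoc]
      | add u v hu hv => simp [add_mul, mul_add, hu, hv]
    have hgg := pow_pred_mul_g (k := k) (m := m) (lam := lam) (NeZero.ne n)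
    ext a
    simp only [LinearMap.comp_apply, Algebra.linearMap_apply]
    induction a using Taft.induction with
    | halg c => simp [antipodeMap_apply]
    | hg => simp [comul_g, counit_g, antipodeMap_apply, antipodeHom_g, hgg]
    | hx => simp [comul_x, counit_x, antipodeMap_apply, antipodeHom_g, antipodeHom_x]
    | hmul a b ha hb =>
      have h2 : ∀ t : Taft k n m lam ⊗[k] Taft k n m lam,
          LinearMap.mul' k _ ((antipodeMap (NeZero.ne n)).rTensor _
            (Coalgebra.comul (R := k) a * t))
          = Coalgebra.counit (R := k) a •
            LinearMap.mul' k _ ((antipodeMap (NeZero.ne n)).rTensor _ t) := by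
        intro t
        induction t with
        | zero => simp
        | tmul b c =>
          rw [key, ha]
          simp [Algebra.algebraMap_eq_smul_one]
        | add u v hu hv => simp [mul_add, hu, hv]
      rw [Bialgebra.comul_mul, h2, hb]
      simp [Algebra.algebraMap_eq_smul_one, smul_smul]
    | hadd a b ha hb => simp only [map_add, ha, hb]
  mul_antipode_lTensor_comul := by
    have key : ∀ u : Taft k n m lam ⊗[k] Taft k n m lam, ∀ b c : Taft k n m lam,
        LinearMap.mul' k _ ((antipodeMap (NeZero.ne n)).lTensor _ (b ⊗ₜ c * u))
          = b * LinearMap.mul' k _ ((antipodeMap (NeZero.ne n)).lTensor _ u)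
            * antipodeMap (NeZero.ne n) c := by
      intro u b c
      induction u with
      | zero => simp
      | tmul a d => simp [antipodeMap_mul, mul_assoc]
      | add u v hu hv => simp [add_mul, mul_add, hu, hv]
    have hgg := g_mul_pow_pred (k := k) (m := m) (lam := lam) (NeZero.ne n)
    ext a
    simp only [LinearMap.comp_apply, Algebra.linearMap_apply]
    induction a using Taft.induction with
    | halg c => simp [antipodeMap_apply]
    | hg => simp [comul_g, counit_g, antipodeMap_apply, antipodeHom_g, hgg]
    | hx =>
      simp [comul_x, counit_x, antipodeMap_apply, antipodeHom_x, ← mul_assoc, hgg]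
    | hmul a b ha hb =>
      have h2 : ∀ t : Taft k n m lam ⊗[k] Taft k n m lam,
          LinearMap.mul' k _ ((antipodeMap (NeZero.ne n)).lTensor _
            (t * Coalgebra.comul (R := k) b))
          = Coalgebra.counit (R := k) b •
            LinearMap.mul' k _ ((antipodeMap (NeZero.ne n)).lTensor _ t) := by
        intro t
        induction t with
        | zero => simp
        | tmul c d =>
          rw [key, hb]
          simp [Algebra.algebraMap_eq_smul_one]
        | add u v hu hv => simp [add_mul, hu, hv]
      rw [Bialgebra.comul_mul, h2, ha]
      simp [Algebra.algebraMap_eq_smul_one, smul_smul, mul_comm]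
    | hadd a b ha hb => simp only [map_add, ha, hb]

end Taft

/-! ### Quantum matrices -/

/-- The defining relations of the single parameter quantum `N × N` matrix algebra. -/
inductive QMatRel (k : Type u) [Field k] (q : k) (N : ℕ) :
    FreeAlgebra k (Fin N × Fin N) → FreeAlgebra k (Fin N × Fin N) → Prop
  | col (i l j : Fin N) (h : i < l) : QMatRel k q N
      (FreeAlgebra.ι k (i, j) * FreeAlgebra.ι k (l, j))
      (q • (FreeAlgebra.ι k (l, j) * FreeAlgebra.ι k (i, j)))
  | row (i j r : Fin N) (h : j < r) : QMatRel k q N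
      (FreeAlgebra.ι k (i, j) * FreeAlgebra.ι k (i, r))
      (q • (FreeAlgebra.ι k (i, r) * FreeAlgebra.ι k (i, j)))
  | anti (i j l r : Fin N) (h : i < l) (h' : r < j) : QMatRel k q N
      (FreeAlgebra.ι k (i, j) * FreeAlgebra.ι k (l, r))
      (FreeAlgebra.ι k (l, r) * FreeAlgebra.ι k (i, j))
  | diag (i j l r : Fin N) (h : i < l) (h' : j < r) : QMatRel k q N
      (FreeAlgebra.ι k (i, j) * FreeAlgebra.ι k (l, r))
      (FreeAlgebra.ι k (l, r) * FreeAlgebra.ι k (i, j)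
        + (q - q⁻¹) • (FreeAlgebra.ι k (i, r) * FreeAlgebra.ι k (l, j)))

/-- The quantum matrix algebra `O_q(M_N(k))`. -/
def QMat (k : Type u) [Field k] (q : k) (N : ℕ) : Type u := RingQuot (QMatRel k q N)

namespace QMat

instance instRing (k : Type u) [Field k] (q : k) (N : ℕ) : Ring (QMat k q N) :=
  inferInstanceAs (Ring (RingQuot (QMatRel k q N)))

instance instAlgebra (k : Type u) [Field k] (q : k) (N : ℕ) : Algebra k (QMat k q N) :=
  inferInstanceAs (Algebra k (RingQuot (QMatRel k q N)))

/-- The generator `Y_{ij}` (rows and columns are numbered from `0`). -/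
def Y (k : Type u) [Field k] (q : k) (N : ℕ) (i j : Fin N) : QMat k q N :=
  RingQuot.mkAlgHom k (QMatRel k q N) (FreeAlgebra.ι k (i, j))

/-- The homogeneous component of degree one, spanned by the generators. -/
def degreeOne (k : Type u) [Field k] (q : k) (N : ℕ) : Submodule k (QMat k q N) :=
  Submodule.span k {y | ∃ i j : Fin N, y = Y k q N i j}

section

variable {k : Type u} [Field k] {q : k} {N : ℕ}

theorem Y_col {i l : Fin N} (j : Fin N) (h : i < l) :
    Y k q N i j * Y k q N l j = q • (Y k q N l j * Y k q N i j) := by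
  have := RingQuot.mkAlgHom_rel k (QMatRel.col (k := k) (q := q) i l j h)
  rw [map_smul, map_mul, map_mul] at this
  exact this

theorem Y_row (i : Fin N) {j r : Fin N} (h : j < r) :
    Y k q N i j * Y k q N i r = q • (Y k q N i r * Y k q N i j) := by
  have := RingQuot.mkAlgHom_rel k (QMatRel.row (k := k) (q := q) i j r h)
  rw [map_smul, map_mul, map_mul] at this
  exact this

theorem Y_anti {i j l r : Fin N} (h : i < l) (h' : r < j) :
    Y k q N i j * Y k q N l r = Y k q N l r * Y k q N i j := by
  have := RingQuot.mkAlgHom_rel k (QMatRel.anti (k := k) (q := q) i j l r h h')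
  rw [map_mul, map_mul] at this
  exact this

theorem Y_diag {i j l r : Fin N} (h : i < l) (h' : j < r) :
    Y k q N i j * Y k q N l r
      = Y k q N l r * Y k q N i j + (q - q⁻¹) • (Y k q N i r * Y k q N l j) := by
  have := RingQuot.mkAlgHom_rel k (QMatRel.diag (k := k) (q := q) i j l r h h')
  rw [map_add, map_smul, map_mul, map_mul, map_mul] at this
  exact this

/-- The universal property of the presentation. -/
def lift {B : Type*} [Ring B] [Algebra k B] (Z : Fin N → Fin N → B)
    (hcol : ∀ i l j, i < l → Z i j * Z l j = q • (Z l j * Z i j))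
    (hrow : ∀ i j r, j < r → Z i j * Z i r = q • (Z i r * Z i j))
    (hanti : ∀ i j l r, i < l → r < j → Z i j * Z l r = Z l r * Z i j)
    (hdiag : ∀ i j l r, i < l → j < r →
      Z i j * Z l r = Z l r * Z i j + (q - q⁻¹) • (Z i r * Z l j)) : QMat k q N →ₐ[k] B :=
  RingQuot.liftAlgHom k ⟨FreeAlgebra.lift k (fun p => Z p.1 p.2), by
    intro a b hab
    cases hab with
    | col i l j h => simpa using hcol i l j h
    | row i j r h => simpa using hrow i j r h
    | anti i j l r h h' => simpa using hanti i j l r h h'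
    | diag i j l r h h' => simpa using hdiag i j l r h h'⟩

theorem lift_Y {B : Type*} [Ring B] [Algebra k B] (Z : Fin N → Fin N → B)
    (hcol hrow hanti hdiag) (i j : Fin N) :
    lift (q := q) Z hcol hrow hanti hdiag (Y k q N i j) = Z i j := by
  refine (RingQuot.liftAlgHom_mkAlgHom_apply (S := k) _ _ _).trans ?_
  simp

theorem algHom_ext {B : Type*} [Semiring B] [Algebra k B] {f f' : QMat k q N →ₐ[k] B}
    (h : ∀ i j, f (Y k q N i j) = f' (Y k q N i j)) : f = f' := by
  refine RingQuot.ringQuot_ext' (S := k) f f' (FreeAlgebra.hom_ext ?_)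
  funext p
  exact h p.1 p.2

/-- The algebra endomorphism `Y_{ij} ↦ a_i b_j Y_{ij}`. -/
def scaleHom (q : k) (a b : Fin N → kˣ) : QMat k q N →ₐ[k] QMat k q N :=
  lift (fun i j => ((a i : k) * (b j : k)) • Y k q N i j)
    (fun i l j h => by
      simp only [smul_mul_smul_comm, Y_col j h, smul_smul]
      congr 1; ring)
    (fun i j r h => by
      simp only [smul_mul_smul_comm, Y_row i h, smul_smul]
      congr 1; ring)
    (fun i j l r h h' => by
      simp only [smul_mul_smul_comm, Y_anti h h']
      congr 1; ring)
    (fun i j l r h h' => by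
      simp only [smul_mul_smul_comm, Y_diag h h', smul_add, smul_smul]
      congr 2 <;> ring)

theorem scaleHom_Y (q : k) (a b : Fin N → kˣ) (i j : Fin N) :
    scaleHom q a b (Y k q N i j) = ((a i : k) * (b j : k)) • Y k q N i j := lift_Y ..

/-- The homomorphism from pairs of vectors of scalars to automorphisms sending `(a, b)` to
`Y_{ij} ↦ a_i b_j Y_{ij}`. -/
def torusHom (k : Type u) [Field k] (q : k) (N : ℕ) :
    (Fin N → kˣ) × (Fin N → kˣ) →* (QMat k q N ≃ₐ[k] QMat k q N) where
  toFun p := AlgEquiv.ofAlgHom (scaleHom q p.1 p.2) (scaleHom q p.1⁻¹ p.2⁻¹)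
    (algHom_ext fun i j => by
      simp only [AlgHom.comp_apply, scaleHom_Y, map_smul, smul_smul, AlgHom.id_apply]
      convert one_smul k _ using 2
      simp; field_simp)
    (algHom_ext fun i j => by
      simp only [AlgHom.comp_apply, scaleHom_Y, map_smul, smul_smul, AlgHom.id_apply]
      convert one_smul k _ using 2
      simp; field_simp)
  map_one' := by
    apply AlgEquiv.coe_toAlgHom_injective
    refine algHom_ext fun i j => ?_
    simp [scaleHom_Y]
  map_mul' p p' := by
    apply AlgEquiv.coe_toAlgHom_injective
    refine algHom_ext fun i j => ?_
    simp [scaleHom_Y, smul_smul]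
    congr 1; ring

/-- The group of diagonal automorphisms `Y_{ij} ↦ a_i b_j Y_{ij}`, with all `a_i, b_j` nonzero.
Normalising the last `b_j` to be `1` gives the same group, a torus of rank `2N - 1`. -/
def torus (k : Type u) [Field k] (q : k) (N : ℕ) : Subgroup (QMat k q N ≃ₐ[k] QMat k q N) :=
  (torusHom k q N).range

/-- The endomorphism `Y_{ij} ↦ Y_{ji}`. -/
def transposeHom (k : Type u) [Field k] (q : k) (N : ℕ) : QMat k q N →ₐ[k] QMat k q N :=
  lift (fun i j => Y k q N j i)
    (fun _ _ j h => Y_row j h) (fun i _ _ h => Y_col i h)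
    (fun _ _ _ _ h h' => (Y_anti h' h).symm)
    (fun i j l r h h' => by rw [Y_diag h' h, Y_anti h' h])

theorem transposeHom_Y (k : Type u) [Field k] (q : k) (N : ℕ) (i j : Fin N) :
    transposeHom k q N (Y k q N i j) = Y k q N j i := lift_Y ..

/-- The transposition automorphism `Y_{ij} ↦ Y_{ji}`. -/
def transpose (k : Type u) [Field k] (q : k) (N : ℕ) : QMat k q N ≃ₐ[k] QMat k q N :=
  AlgEquiv.ofAlgHom (transposeHom k q N) (transposeHom k q N)
    (algHom_ext fun i j => by simp [transposeHom_Y])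
    (algHom_ext fun i j => by simp [transposeHom_Y])

/-- The group of automorphisms generated by the diagonal automorphisms and transposition; since
transposition normalises the torus, this is the (internal) semidirect product. -/
def torusTranspose (k : Type u) [Field k] (q : k) (N : ℕ) :
    Subgroup (QMat k q N ≃ₐ[k] QMat k q N) :=
  torus k q N ⊔ Subgroup.zpowers (transpose k q N)

end

end QMat

/-! ### Actions -/

/-- An action of a Hopf algebra `H` on an algebra `A`, that is, a left `H`-module algebra structure
on `A`: a left `H`-module structure `h ⊗ a ↦ act h a` with `act h 1 = ε(h) 1` and
`act h (a b) = ∑ (act h₁ a) (act h₂ b)`. -/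
structure HopfAction (k : Type u) [Field k] (H : Type u) [Ring H] [HopfAlgebra k H]
    (A : Type u) [Ring A] [Algebra k A] where
  act : H →ₐ[k] Module.End k A
  act_one : ∀ h : H, act h 1 = algebraMap k A (Coalgebra.counit (R := k) h)
  act_mul : ∀ (h : H) (a b : A), act h (a * b) = LinearMap.mul' k A
    (TensorProduct.map (act.toLinearMap.flip a) (act.toLinearMap.flip b)
      (Coalgebra.comul (R := k) h))

section

variable {k : Type u} [Field k] {q : k} {N n m : ℕ} {lam : k} [NeZero n] [NeZero m]
  [Fact (IsPrimitiveRoot lam m)]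

/-- `x` acts linearly and nonzero, and `g` acts as an element of the group generated by the torus
and transposition. -/
structure IsAdmissible (ρ : HopfAction k (Taft k n m lam) (QMat k q N)) : Prop where
  x_linear : ∀ y ∈ QMat.degreeOne k q N, ρ.act (Taft.x k n m lam) y ∈ QMat.degreeOne k q N
  x_ne_zero : ρ.act (Taft.x k n m lam) ≠ 0
  g_mem : ∃ φ ∈ QMat.torusTranspose k q N, ∀ y, ρ.act (Taft.g k n m lam) y = φ y

end

/-- The labels of the eight families of actions (with their row or column parameter). Rows and
columns are numbered from `0` to `N - 1`. -/
inductive Family (N : ℕ) : Type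
  /-- `x` moves column `b` to the column `b' = b - 1` on its left. -/
  | colLeft (b b' : Fin N) (h : (b' : ℕ) + 1 = b)
  /-- `x` moves row `a` to the row `a' = a - 1` above it. -/
  | rowUp (a a' : Fin N) (h : (a' : ℕ) + 1 = a)
  /-- `x` moves the first corner to the top right corner. -/
  | firstToTopRight
  /-- `x` moves the first corner to the bottom left corner. -/
  | firstToBottomLeft
  /-- `x` moves column `b` to the column `b' = b + 1` on its right. -/
  | colRight (b b' : Fin N) (h : (b : ℕ) + 1 = b')
  /-- `x` moves row `a` to the row `a' = a + 1` below it. -/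
  | rowDown (a a' : Fin N) (h : (a : ℕ) + 1 = a')
  /-- `x` moves the last corner to the top right corner. -/
  | lastToTopRight
  /-- `x` moves the last corner to the bottom left corner. -/
  | lastToBottomLeft

namespace Family

/-- The value of `lam` in each family. -/
def lamValue {k : Type u} [Field k] (q : k) {N : ℕ} : Family N → k
  | colLeft _ _ _ | rowUp _ _ _ | firstToTopRight | firstToBottomLeft => q ^ 2
  | colRight _ _ _ | rowDown _ _ _ | lastToTopRight | lastToBottomLeft => (q ^ 2)⁻¹

/-- The weights `α i j` with `g · Y_{ij} = α i j Y_{ij}` in each family. -/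
def gWeight {k : Type u} [Field k] (q : k) {N : ℕ} [NeZero N] : Family N → Fin N → Fin N → k
  | colLeft b b' _ => fun _ j => if j = b' then q else if j = b then q⁻¹ else 1
  | rowUp a a' _ => fun i _ => if i = a' then q else if i = a then q⁻¹ else 1
  | firstToTopRight => fun i j => (if i = 0 then (q ^ 2)⁻¹ else 1) *
      (if j = 0 then q⁻¹ else if j = Fin.rev 0 then q else 1)
  | firstToBottomLeft => fun i j => (if j = 0 then (q ^ 2)⁻¹ else 1) *
      (if i = 0 then q⁻¹ else if i = Fin.rev 0 then q else 1)
  | colRight b b' _ => fun _ j => if j = b then q else if j = b' then q⁻¹ else 1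
  | rowDown a a' _ => fun i _ => if i = a then q else if i = a' then q⁻¹ else 1
  | lastToTopRight => fun i j => (if j = Fin.rev 0 then q ^ 2 else 1) *
      (if i = 0 then q⁻¹ else if i = Fin.rev 0 then q else 1)
  | lastToBottomLeft => fun i j => (if i = Fin.rev 0 then q ^ 2 else 1) *
      (if j = 0 then q⁻¹ else if j = Fin.rev 0 then q else 1)

/-- The element `x · Y_{ij}` in each family with `d` in place of the scalar `δ`. -/
def xValue {k : Type u} [Field k] (q : k) {N : ℕ} [NeZero N] (d : k) :
    Family N → Fin N → Fin N → QMat k q N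
  | colLeft b b' _ => fun i j => if j = b then d • QMat.Y k q N i b' else 0
  | rowUp a a' _ => fun i j => if i = a then d • QMat.Y k q N a' j else 0
  | firstToTopRight => fun i j =>
      if i = 0 ∧ j = 0 then d • QMat.Y k q N 0 (Fin.rev 0) else 0
  | firstToBottomLeft => fun i j =>
      if i = 0 ∧ j = 0 then d • QMat.Y k q N (Fin.rev 0) 0 else 0
  | colRight b b' _ => fun i j => if j = b then d • QMat.Y k q N i b' else 0
  | rowDown a a' _ => fun i j => if i = a then d • QMat.Y k q N a' j else 0
  | lastToTopRight => fun i j =>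
      if i = Fin.rev 0 ∧ j = Fin.rev 0 then d • QMat.Y k q N 0 (Fin.rev 0) else 0
  | lastToBottomLeft => fun i j =>
      if i = Fin.rev 0 ∧ j = Fin.rev 0 then d • QMat.Y k q N (Fin.rev 0) 0 else 0

end Family

/-- On the generators `Y_{ij}`, the elements `g` and `x` act as prescribed by the family `f` with
scalar `d`. -/
def IsGivenBy {k : Type u} [Field k] {q : k} {N n m : ℕ} {lam : k} [NeZero N] [NeZero n] [NeZero m]
    [Fact (IsPrimitiveRoot lam m)] (ρ : HopfAction k (Taft k n m lam) (QMat k q N))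
    (f : Family N) (d : k) : Prop :=
  ∀ i j : Fin N,
    ρ.act (Taft.g k n m lam) (QMat.Y k q N i j) = f.gWeight q i j • QMat.Y k q N i j ∧
    ρ.act (Taft.x k n m lam) (QMat.Y k q N i j) = f.xValue q d i j

end QuantumMatrixActions

end

/-! An action amounts to an algebra endomorphism G with G^n = 1 and a skew derivation X, X(ab) =
X(a)b + G(a)X(b), such that GX = lam XG and X^m = 0. The last condition can be tested on generators:
the Gaussian binomials at a primitive m-th root of unity vanish, so X^m is a skew derivation for G^m
(`skewDer_pow_mul`). Everything is thus decided by the matrix C of X on the span V of the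
generators, and by whether X respects the quadratic relations.

This is tested dually. A bilinear form on V that satisfies the relations is a functional on the
degree two component, and X respects the relations when its transpose `twist` preserves these forms
(`Compatible`). Such forms can be prescribed freely on normally ordered monomials (`quadForm`), and
each is realized on a module k ⊕ V ⊕ M (`QMat.exists_functional`), so no PBW basis is needed.
Conversely, a compatible C yields X as the corner entry of a homomorphism to upper triangular 2 × 2
matrices (`exists_skewDer`).

Let G be diagonal. The relations are homogeneous for the torus weights, so every weight component of
C is again compatible. Such a component moves one column to another, or one row to another, or is a
single arrow that changes both indices. The last is impossible for N ≥ 3. If c_i is the coefficient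
of Y_ij → Y_ir with j < r, the relations force the nonzero c_i to be equal and to occupy an initial
segment of rows. Either all rows occur, the two columns are adjacent and lam = q⁻²; or only the
first row occurs, the arrow joins the two upper corners and lam = q² (`classify_row_right`).
Transposition, and reversal of both index orders with q ↔ q⁻¹, produce the eight families from these
two. As m ≥ 3 gives lam² ≠ 1, hence q⁴ ≠ 1, the weights and lam determine the family, so C involves
only one (`Family.gWeight_injective`).

If G involves the transposition, a weight argument leaves only the entries Y_p → Y_p and Y_p →
Y_{swap p}, and lam² ≠ 1 kills these (`transposed_eq_zero`). Finally q is an eigenvalue of g in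
every family, so q^n = 1. -/

noncomputable section

universe u

namespace QuantumMatrixActions

/-! ### Bilinear forms on the generators satisfying the quadratic relations -/

section Forms

variable {k : Type u} [Field k] {N : ℕ} {M : Type*} [AddCommGroup M] [Module k M]

/-- A family of elements indexed by pairs of generators that satisfies the defining relations of
`O_q(M_N(k))`. -/
structure IsQuadratic (q : k) (β : Fin N × Fin N → Fin N × Fin N → M) : Prop where
  col : ∀ i l j, i < l → β (i, j) (l, j) = q • β (l, j) (i, j)
  row : ∀ i j r, j < r → β (i, j) (i, r) = q • β (i, r) (i, j)
  anti : ∀ i j l r, i < l → r < j → β (i, j) (l, r) = β (l, r) (i, j)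
  diag : ∀ i j l r, i < l → j < r →
    β (i, j) (l, r) = β (l, r) (i, j) + (q - q⁻¹) • β (i, r) (l, j)

/-- The reversal of both indices. -/
def revPair (p : Fin N × Fin N) : Fin N × Fin N := (p.1.rev, p.2.rev)

@[simp] theorem revPair_mk (i j : Fin N) : revPair (i, j) = (i.rev, j.rev) := rfl

@[simp] theorem revPair_revPair (p : Fin N × Fin N) : revPair (revPair p) = p := by
  simp [revPair]

/-- Column and row relations are interchanged. In the diagonal relation the two antidiagonal
generators commute, so their order is immaterial. -/
theorem IsQuadratic.swap {q : k} {β : Fin N × Fin N → Fin N × Fin N → M}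
    (h : IsQuadratic q β) : IsQuadratic q fun p t => β p.swap t.swap where
  col i l j hil := h.row j i l hil
  row i j r hjr := h.col j r i hjr
  anti i j l r hil hrj := (h.anti r l j i hrj hil).symm
  diag i j l r hil hjr := by
    have h1 := h.diag j i r l hjr hil
    have h2 := h.anti j l r i hjr hil
    simp only [Prod.swap_prod_mk]
    rw [h1, h2]

/-- Reversing both orders reads each relation backwards, which replaces q by q⁻¹ and changes the
sign of q - q⁻¹. -/
theorem IsQuadratic.rev {q : k} (hq : q ≠ 0) {β : Fin N × Fin N → Fin N × Fin N → M}
    (h : IsQuadratic q β) : IsQuadratic q⁻¹ fun p t => β (revPair p) (revPair t) where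
  col i l j hil := by
    have := h.col l.rev i.rev j.rev (Fin.rev_lt_rev.mpr hil)
    simp only [revPair_mk]
    rw [this, smul_smul, inv_mul_cancel₀ hq, one_smul]
  row i j r hjr := by
    have := h.row i.rev r.rev j.rev (Fin.rev_lt_rev.mpr hjr)
    simp only [revPair_mk]
    rw [this, smul_smul, inv_mul_cancel₀ hq, one_smul]
  anti i j l r hil hrj :=
    (h.anti l.rev r.rev i.rev j.rev (Fin.rev_lt_rev.mpr hil) (Fin.rev_lt_rev.mpr hrj)).symm
  diag i j l r hil hjr := by
    have h1 := h.diag l.rev r.rev i.rev j.rev (Fin.rev_lt_rev.mpr hil) (Fin.rev_lt_rev.mpr hjr)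
    have h2 := h.anti l.rev j.rev i.rev r.rev (Fin.rev_lt_rev.mpr hil) (Fin.rev_lt_rev.mpr hjr)
    simp only [revPair_mk]
    rw [h1, h2, add_assoc, ← add_smul]
    simp

/-- The quadratic form with prescribed values `f` on the monomials that are not increasing. -/
def quadForm (q : k) (f : Fin N × Fin N → Fin N × Fin N → k) (p s : Fin N × Fin N) : k :=
  (if (p.1 = s.1 ∧ p.2 < s.2) ∨ (p.2 = s.2 ∧ p.1 < s.1) then q else 1) * f p s +
    if p.1 < s.1 ∧ p.2 < s.2 then (q - q⁻¹) * f (p.1, s.2) (s.1, p.2) else 0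

theorem isQuadratic_quadForm (q : k) {f : Fin N × Fin N → Fin N × Fin N → k}
    (hf : ∀ p s, f p s = f s p) : IsQuadratic q (quadForm q f) where
  col i l j h := by
    simp [quadForm, h, h.not_gt, h.ne, h.ne', hf (i, j)]
  row i j r h := by
    simp [quadForm, h, h.not_gt, h.ne, h.ne', hf (i, j)]
  anti i j l r h h' := by
    simp [quadForm, h, h', h.not_gt, h'.not_gt, h.ne, h.ne', h'.ne, h'.ne', hf (i, j)]
  diag i j l r h h' := by
    simp [quadForm, h, h', h.not_gt, h'.not_gt, h.ne, h.ne', h'.ne, h'.ne', hf (i, j)]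

/-- The four generators of a 2 × 2 minor span, by diagonal and antidiagonal products, a space with
two free coordinates x and y; the other two values are forced. -/
theorem exists_isQuadratic_square (q : k) {i l j r : Fin N} (h : i < l) (h' : j < r) (x y : k) :
    ∃ β : Fin N × Fin N → Fin N × Fin N → k, IsQuadratic q β ∧ β (i, j) (l, r) = x ∧
      β (l, r) (i, j) = x - (q - q⁻¹) * y ∧ β (i, r) (l, j) = y ∧ β (l, j) (i, r) = y := by
  refine ⟨quadForm q fun p s =>
    if (p = (i, j) ∧ s = (l, r)) ∨ (p = (l, r) ∧ s = (i, j)) then x - (q - q⁻¹) * y else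
    if (p = (i, r) ∧ s = (l, j)) ∨ (p = (l, j) ∧ s = (i, r)) then y else 0,
    isQuadratic_quadForm q fun p s => ?_, ?_, ?_, ?_, ?_⟩
  · congr 1
    · simp only [eq_iff_iff]; tauto
    · congr 1
      simp only [eq_iff_iff]; tauto
  all_goals simp [quadForm, h, h', h.not_gt, h'.not_gt, h.ne, h.ne', h'.ne, h'.ne']

/-- The torus weight of a generator. -/
def weight (p : Fin N × Fin N) : (Fin N → ℤ) × (Fin N → ℤ) :=
  (Pi.single p.1 1, Pi.single p.2 1)

/-- All monomials in one relation have the same torus weight. -/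
theorem IsQuadratic.component {q : k} {β : Fin N × Fin N → Fin N × Fin N → M}
    (h : IsQuadratic q β) (v : (Fin N → ℤ) × (Fin N → ℤ)) :
    IsQuadratic q fun p t => if weight p + weight t = v then β p t else 0 where
  col i l j hil := by
    rw [add_comm (weight (l, j)), h.col i l j hil, smul_ite, smul_zero]
  row i j r hjr := by
    rw [add_comm (weight (i, r)), h.row i j r hjr, smul_ite, smul_zero]
  anti i j l r hil hrj := by
    rw [add_comm (weight (l, r)), h.anti i j l r hil hrj]
  diag i j l r hil hjr := by
    have : weight (i, r) + weight (l, j) = weight (i, j) + weight (l, r) := by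
      simp [weight, add_comm]
    rw [add_comm (weight (l, r)), this, h.diag i j l r hil hjr]
    split_ifs <;> simp

/-- The dual form of the fact that a product of two generators is not zero. It serves to cancel a
common monomial in the comparisons below. -/
theorem exists_isQuadratic_ne_zero {q : k} (hq : q ≠ 0) (s t : Fin N × Fin N) :
    ∃ β : Fin N × Fin N → Fin N × Fin N → k, IsQuadratic q β ∧ β s t ≠ 0 := by
  refine ⟨quadForm q fun x y => if (x = s ∧ y = t) ∨ (x = t ∧ y = s) then 1 else 0,
    isQuadratic_quadForm q fun p s => ?_, ?_⟩
  · congr 1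
    simp only [eq_iff_iff]; tauto
  -- The correction term of `quadForm` sees the antidiagonal of the minor, which is never the pair
  -- {s, t} itself; so the value at (s, t) is q or 1.
  · have : ¬ ((s.1 < t.1 ∧ s.2 < t.2) ∧ (((s.1, t.2) = s ∧ (t.1, s.2) = t) ∨
        ((s.1, t.2) = t ∧ (t.1, s.2) = s))) := by
      rintro ⟨⟨h1, h2⟩, ⟨h3, -⟩ | ⟨h3, -⟩⟩
      · exact h2.ne' (Prod.ext_iff.mp h3).2
      · exact h1.ne (Prod.ext_iff.mp h3).1
    unfold quadForm
    have h0 : (if s.1 < t.1 ∧ s.2 < t.2 then (q - q⁻¹) *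
        (if ((s.1, t.2) = s ∧ (t.1, s.2) = t) ∨ ((s.1, t.2) = t ∧ (t.1, s.2) = s)
          then (1 : k) else 0) else 0) = 0 := by
      split_ifs with h1 h2
      · exact absurd ⟨h1, h2⟩ this
      all_goals simp
    rw [h0]
    split_ifs <;> simp_all

/-! ### The transpose of a skew derivation, acting on quadratic forms -/

/-- The form obtained from `β` by the action of a skew derivation with matrix `C` on the
generators, relative to the automorphism `Y_p ↦ α_p Y_{π p}`. -/
def twist (π : Fin N × Fin N → Fin N × Fin N) (α : Fin N × Fin N → k)
    (C : Fin N × Fin N → Fin N × Fin N → k) (β : Fin N × Fin N → Fin N × Fin N → M)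
    (p t : Fin N × Fin N) : M :=
  ∑ s, C p s • β s t + α p • ∑ s, C t s • β (π p) s

variable (M) in
/-- The twist operation preserves the quadratic relations. -/
def Compatible (q : k) (π : Fin N × Fin N → Fin N × Fin N) (α : Fin N × Fin N → k)
    (C : Fin N × Fin N → Fin N × Fin N → k) : Prop :=
  ∀ β : Fin N × Fin N → Fin N × Fin N → M, IsQuadratic q β → IsQuadratic q (twist π α C β)

theorem Compatible.swap {q : k} {π : Fin N × Fin N → Fin N × Fin N} {α : Fin N × Fin N → k}
    {C : Fin N × Fin N → Fin N × Fin N → k} (h : Compatible M q π α C) :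
    Compatible M q (fun p => (π p.swap).swap) (fun p => α p.swap) (fun p s => C p.swap s.swap) := by
  intro β hβ
  convert (h _ hβ.swap).swap using 3 with p t
  simp only [twist]
  congr 1
  · exact (Equiv.prodComm (Fin N) (Fin N)).sum_comp fun s => C p.swap s • β s.swap t
  · congr 1
    exact (Equiv.prodComm (Fin N) (Fin N)).sum_comp fun s => C t.swap s • β (π p.swap).swap s.swap

/-- Reversal of both indices as a permutation. -/
def revPairEquiv : Fin N × Fin N ≃ Fin N × Fin N :=
  ⟨revPair, revPair, revPair_revPair, revPair_revPair⟩

theorem Compatible.rev {q : k} (hq : q ≠ 0) {α : Fin N × Fin N → k}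
    {C : Fin N × Fin N → Fin N × Fin N → k} (h : Compatible M q id α C) :
    Compatible M q⁻¹ id (fun p => α (revPair p)) (fun p s => C (revPair p) (revPair s)) := by
  intro β hβ
  have hβ' := hβ.rev (inv_ne_zero hq)
  rw [inv_inv] at hβ'
  convert (h _ hβ').rev hq using 3 with p t
  simp only [twist, id, revPair_revPair]
  congr 1
  · exact Fintype.sum_equiv revPairEquiv _ _ fun s => by simp [revPairEquiv]
  · congr 1
    exact Fintype.sum_equiv revPairEquiv _ _ fun s => by simp [revPairEquiv]

/-- For a diagonal automorphism the twist by a weight-homogeneous matrix shifts weights by a fixed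
amount. So homogeneous parts of C can be studied one at a time; the part kept here is that of the
arrow p₀ → s₀. -/
theorem Compatible.component {q : k} {α : Fin N × Fin N → k}
    {C : Fin N × Fin N → Fin N × Fin N → k} (h : Compatible M q id α C) (p₀ s₀ : Fin N × Fin N) :
    Compatible M q id α
      (fun p s => if weight s + weight p₀ = weight p + weight s₀ then C p s else 0) := by
  intro β hβ
  -- On pairs of weight v, truncating C has the same effect as truncating β to the shifted weight.
  have key : ∀ p t v, weight p + weight t = v → twist id α
      (fun p s => if weight s + weight p₀ = weight p + weight s₀ then C p s else 0) β p t =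
      twist id α C (fun x y => if weight x + weight y = v + weight s₀ - weight p₀ then β x y else 0)
        p t := by
    rintro p t _ rfl
    simp only [twist, id, smul_ite, ite_smul, zero_smul, smul_zero]
    congr 1
    · refine Finset.sum_congr rfl fun s _ => ?_
      congr 1
      rw [eq_iff_iff, eq_sub_iff_add_eq, add_right_comm, add_right_comm (weight p),
        add_left_inj]
    · congr 1
      refine Finset.sum_congr rfl fun s _ => ?_
      congr 1
      rw [eq_iff_iff, eq_sub_iff_add_eq, add_assoc, add_assoc (weight p),
        add_right_inj]
  constructor
  · intro i l j hil
    rw [key _ _ _ rfl, key (l, j) (i, j) _ (add_comm _ _)]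
    exact (h _ (hβ.component _)).col i l j hil
  · intro i j r hjr
    rw [key _ _ _ rfl, key (i, r) (i, j) _ (add_comm _ _)]
    exact (h _ (hβ.component _)).row i j r hjr
  · intro i j l r hil hrj
    rw [key _ _ _ rfl, key (l, r) (i, j) _ (add_comm _ _)]
    exact (h _ (hβ.component _)).anti i j l r hil hrj
  · intro i j l r hil hjr
    rw [key _ _ _ rfl, key (l, r) (i, j) _ (add_comm _ _),
      key (i, r) (l, j) (weight (i, j) + weight (l, r)) (by simp [weight, add_comm])]
    exact (h _ (hβ.component _)).diag i j l r hil hjr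

theorem twist_monomial (π : Fin N × Fin N → Fin N × Fin N) (α e : Fin N × Fin N → k)
    (φ : Fin N × Fin N → Fin N × Fin N) (β : Fin N × Fin N → Fin N × Fin N → M)
    (p t : Fin N × Fin N) :
    twist π α (fun p s => if s = φ p then e p else 0) β p t =
      e p • β (φ p) t + (α p * e t) • β (π p) (φ t) := by
  simp [twist, smul_smul]

theorem single_add_single_eq {i l x y : Fin N} (hil : i ≠ l)
    (h : (Pi.single y 1 + Pi.single i 1 : Fin N → ℤ) = Pi.single x 1 + Pi.single l 1) :
    x = i ∧ y = l := by
  have h1 := congrFun h i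
  have h2 := congrFun h l
  simp only [Pi.add_apply, Pi.single_apply] at h1 h2
  constructor
  · by_contra hx
    simp [hil, Ne.symm hx] at h1
    split_ifs at h1 <;> omega
  · by_contra hy
    simp [hil.symm, Ne.symm hy] at h2
    split_ifs at h2 <;> omega

/-- A shift of the column alone leaves the row free, so the component of such an arrow contains the
parallel arrows in all rows. -/
theorem weight_shift_row {i j r : Fin N} (hjr : j ≠ r) (p s : Fin N × Fin N) :
    weight s + weight (i, j) = weight p + weight (i, r) ↔ p.2 = j ∧ s = (p.1, r) := by
  constructor
  · intro h
    simp only [weight, Prod.mk_add_mk, Prod.mk.injEq, add_left_inj] at h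
    obtain ⟨h1, h2⟩ := h
    obtain ⟨h3, h4⟩ := single_add_single_eq hjr h2
    have h5 : s.1 = p.1 := by
      have := congrFun h1 s.1
      by_contra hne
      simp [hne] at this
    exact ⟨h3, Prod.ext h5 h4⟩
  · rintro ⟨rfl, rfl⟩
    simp [weight, add_comm]

/-- When both indices change, the weight shift determines source and target, so the component is a
single arrow. -/
theorem weight_shift_of_ne {i j l r : Fin N} (hil : i ≠ l) (hjr : j ≠ r) (p s : Fin N × Fin N) :
    weight s + weight (i, j) = weight p + weight (l, r) ↔ p = (i, j) ∧ s = (l, r) := by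
  constructor
  · intro h
    simp only [weight, Prod.mk_add_mk, Prod.mk.injEq] at h
    obtain ⟨h1, h2⟩ := single_add_single_eq hil h.1
    obtain ⟨h3, h4⟩ := single_add_single_eq hjr h.2
    exact ⟨Prod.ext h1 h3, Prod.ext h2 h4⟩
  · rintro ⟨rfl, rfl⟩
    rw [add_comm]

end Forms

/-! ### Low degree components of the quantum matrix algebra -/

namespace QMat

variable {k : Type u} [Field k] {q : k} {N : ℕ}

theorem induction {P : QMat k q N → Prop} (halg : ∀ c : k, P (algebraMap k _ c))
    (hY : ∀ i j, P (Y k q N i j)) (hmul : ∀ a b, P a → P b → P (a * b))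
    (hadd : ∀ a b, P a → P b → P (a + b)) (a : QMat k q N) : P a := by
  obtain ⟨w, rfl⟩ := RingQuot.mkAlgHom_surjective k (QMatRel k q N) a
  induction w using FreeAlgebra.induction with
  | grade0 c => rw [AlgHom.commutes]; exact halg c
  | grade1 i => exact hY i.1 i.2
  | mul a b ha hb => rw [map_mul]; exact hmul _ _ ha hb
  | add a b ha hb => rw [map_add]; exact hadd _ _ ha hb

/-- The generator `Y_{ij}` as a function of a pair. -/
def gen (k : Type u) [Field k] (q : k) (N : ℕ) (p : Fin N × Fin N) : QMat k q N :=
  Y k q N p.1 p.2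

theorem isQuadratic_mul (q : k) (N : ℕ) :
    IsQuadratic q fun p t => gen k q N p * gen k q N t where
  col _ _ j h := Y_col j h
  row i _ _ h := Y_row i h
  anti _ _ _ _ h h' := Y_anti h h'
  diag _ _ _ _ h h' := Y_diag h h'

/-! ### A truncated module realizing prescribed products in degree two -/

section Truncation

variable {M : Type*} [AddCommGroup M] [Module k M]

/-- The operator of multiplication by `Y_p` on the truncation `k ⊕ V ⊕ M`, where the product of
two generators is given by `β`. -/
def truncMul (β : Fin N × Fin N → Fin N × Fin N → M) (p : Fin N × Fin N) :
    Module.End k (k × (Fin N × Fin N → k) × M) where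
  toFun w := (0, w.1 • Pi.single p 1, ∑ s, w.2.1 s • β p s)
  map_add' w w' := by simp [add_smul, Finset.sum_add_distrib]
  map_smul' c w := by simp [smul_smul, Finset.smul_sum]

theorem truncMul_mul (β : Fin N × Fin N → Fin N × Fin N → M) (p t : Fin N × Fin N) :
    truncMul β p * truncMul β t = LinearMap.inr k k _ ∘ₗ LinearMap.inr k (Fin N × Fin N → k) M ∘ₗ
      (LinearMap.toSpanSingleton k M (β p t)) ∘ₗ LinearMap.fst k k _ := by
  refine LinearMap.ext fun w => ?_
  simp [truncMul, Pi.single_apply, ite_smul]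

/-- The product of two operators `truncMul` depends only on β, linearly, so the relations for β make
k ⊕ V ⊕ M a module over the quantum matrix algebra. Applying elements to (1, 0, 0) gives f. -/
theorem exists_functional {β : Fin N × Fin N → Fin N × Fin N → M} (hβ : IsQuadratic q β) :
    ∃ f : QMat k q N →ₗ[k] (k × (Fin N × Fin N → k) × M),
      (∀ p, f (gen k q N p) = (0, Pi.single p 1, 0)) ∧
      ∀ p t, f (gen k q N p * gen k q N t) = (0, 0, β p t) := by
  let R : QMat k q N →ₐ[k] Module.End k (k × (Fin N × Fin N → k) × M) :=
    lift (fun i j => truncMul β (i, j))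
      (fun i l j h => by
        simp only [truncMul_mul, hβ.col i l j h]
        ext <;> simp)
      (fun i j r h => by
        simp only [truncMul_mul, hβ.row i j r h]
        ext <;> simp)
      (fun i j l r h h' => by
        simp only [truncMul_mul, hβ.anti i j l r h h'])
      (fun i j l r h h' => by
        simp only [truncMul_mul, hβ.diag i j l r h h']
        ext <;> simp)
  have hR : ∀ p, R (gen k q N p) = truncMul β p := fun p => lift_Y ..
  refine ⟨(LinearMap.applyₗ (1, 0, 0)) ∘ₗ R.toLinearMap, fun p => ?_, fun p t => ?_⟩
  · simp [hR, truncMul]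
  · simp [hR, truncMul_mul]

end Truncation

theorem linearIndependent_gen (q : k) (N : ℕ) : LinearIndependent k (gen k q N) := by
  obtain ⟨f, hf, -⟩ := exists_functional (q := q) (N := N)
    (β := fun _ _ => (0 : k)) ⟨by simp, by simp, by simp, by simp⟩
  refine LinearIndependent.of_comp (LinearMap.fst k _ _ ∘ₗ LinearMap.snd k _ _ ∘ₗ f) ?_
  convert (Pi.basisFun k (Fin N × Fin N)).linearIndependent using 1
  funext p
  simp [hf]

theorem gen_ne_zero (q : k) (N : ℕ) (p : Fin N × Fin N) : gen k q N p ≠ 0 :=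
  (linearIndependent_gen q N).ne_zero p

end QMat

/-! ### Actions as pairs of an automorphism and a skew derivation -/

section Actions

variable {k : Type u} [Field k] {n m : ℕ} {lam : k}

/-! ### Actions on an arbitrary algebra -/

section General

variable {A : Type u} [Ring A] [Algebra k A]

/-- On A ⊗ A put P = X ⊗ 1 and Q = G ⊗ X. Then QP = lam PQ, and at a primitive m-th root of unity
only the extreme terms P^m and Q^m of (P + Q)^m survive. -/
theorem skewDer_pow_mul (hlam : IsPrimitiveRoot lam m) (hm : m ≠ 0) {G : A →ₐ[k] A}
    {X : A →ₗ[k] A}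
    (hX : ∀ a b, X (a * b) = X a * b + G a * X b) (hGX : ∀ a, G (X a) = lam • X (G a)) (a b : A) :
    (X ^ m) (a * b) = (X ^ m) a * b + (G ^ m) a * (X ^ m) b := by
  let P : Module.End k (A ⊗[k] A) := TensorProduct.map X LinearMap.id
  let Q : Module.End k (A ⊗[k] A) := TensorProduct.map G.toLinearMap X
  have hQP : Q * P = lam • (P * Q) := by
    refine TensorProduct.ext' fun a b => ?_
    simp [P, Q, hGX, TensorProduct.smul_tmul']
  have hμ : X ∘ₗ LinearMap.mul' k A = LinearMap.mul' k A ∘ₗ (P + Q) := by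
    refine TensorProduct.ext' fun a b => ?_
    simp [P, Q, hX]
  have hμr : ∀ r : ℕ, (X ^ r) ∘ₗ LinearMap.mul' k A = LinearMap.mul' k A ∘ₗ ((P + Q) ^ r) := by
    intro r
    induction r with
    | zero => rfl
    | succ r ih =>
      rw [pow_succ', pow_succ, Module.End.mul_eq_comp, Module.End.mul_eq_comp,
        LinearMap.comp_assoc, ih, ← LinearMap.comp_assoc, hμ, LinearMap.comp_assoc,
        ← Module.End.mul_eq_comp (P + Q), ← Module.End.mul_eq_comp _ (P + Q), ← pow_succ,
        ← pow_succ']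
  have hP : ∀ r : ℕ, ∀ a b, (P ^ r) (a ⊗ₜ b) = (X ^ r) a ⊗ₜ b := by
    intro r
    induction r with
    | zero => intro a b; rfl
    | succ r ih =>
      intro a b
      rw [pow_succ', pow_succ', Module.End.mul_apply, ih]
      rfl
  have hQ : ∀ r : ℕ, ∀ a b, (Q ^ r) (a ⊗ₜ b) = (G ^ r) a ⊗ₜ (X ^ r) b := by
    intro r
    induction r with
    | zero => intro a b; rfl
    | succ r ih =>
      intro a b
      rw [pow_succ', pow_succ', pow_succ', Module.End.mul_apply, ih]
      rfl
  have hsum : (P + Q) ^ m = P ^ m + Q ^ m := by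
    obtain ⟨r, rfl⟩ := Nat.exists_eq_succ_of_ne_zero hm
    rw [skew_add_pow lam hQP, Finset.sum_range_succ, Finset.sum_range_succ',
      Finset.sum_eq_zero fun s hs => ?_]
    · have h1 : gaussBinom lam (r + 1) (r + 1) = 1 := by
        have : ∀ s : ℕ, gaussBinom lam s s = 1 := by
          intro s
          induction s with
          | zero => rfl
          | succ s ih => simp [gaussBinom, ih, gaussBinom_eq_zero_of_lt lam s (s + 1) (by omega)]
        exact this _
      simp [gaussBinom_zero_right, h1, add_comm]
    · rw [gaussBinom_primitive hlam s (by have := Finset.mem_range.mp hs; omega), zero_smul]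
  have := LinearMap.congr_fun (hμr m) (a ⊗ₜ b)
  simpa [hsum, hP, hQ] using this

variable [NeZero n] [NeZero m] [Fact (IsPrimitiveRoot lam m)]

theorem HopfAction.g_one (ρ : HopfAction k (Taft k n m lam) A) :
    ρ.act (Taft.g k n m lam) 1 = 1 := by
  simp [ρ.act_one, Taft.counit_g]

theorem HopfAction.g_mul (ρ : HopfAction k (Taft k n m lam) A) (a b : A) :
    ρ.act (Taft.g k n m lam) (a * b) =
      ρ.act (Taft.g k n m lam) a * ρ.act (Taft.g k n m lam) b := by
  simp [ρ.act_mul, Taft.comul_g]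

theorem HopfAction.x_one (ρ : HopfAction k (Taft k n m lam) A) :
    ρ.act (Taft.x k n m lam) 1 = 0 := by
  simp [ρ.act_one, Taft.counit_x]

theorem HopfAction.x_mul (ρ : HopfAction k (Taft k n m lam) A) (a b : A) :
    ρ.act (Taft.x k n m lam) (a * b) = ρ.act (Taft.x k n m lam) a * b +
      ρ.act (Taft.g k n m lam) a * ρ.act (Taft.x k n m lam) b := by
  simp [ρ.act_mul, Taft.comul_x]

/-- The automorphism by which `g` acts, as an algebra map. -/
def HopfAction.gHom (ρ : HopfAction k (Taft k n m lam) A) : A →ₐ[k] A :=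
  AlgHom.ofLinearMap (ρ.act (Taft.g k n m lam)) ρ.g_one ρ.g_mul

theorem HopfAction.g_pow_apply (ρ : HopfAction k (Taft k n m lam) A) (a : A) :
    (ρ.act (Taft.g k n m lam) ^ n) a = a := by
  rw [← map_pow, Taft.g_pow, map_one, Module.End.one_apply]

theorem HopfAction.g_x_apply (ρ : HopfAction k (Taft k n m lam) A) (a : A) :
    ρ.act (Taft.g k n m lam) (ρ.act (Taft.x k n m lam) a) =
      lam • ρ.act (Taft.x k n m lam) (ρ.act (Taft.g k n m lam) a) := by
  rw [← Module.End.mul_apply, ← map_mul, Taft.g_mul_x, map_smul, map_mul]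
  rfl

theorem HopfAction.ext_gx {ρ σ : HopfAction k (Taft k n m lam) A}
    (hg : ρ.act (Taft.g k n m lam) = σ.act (Taft.g k n m lam))
    (hx : ρ.act (Taft.x k n m lam) = σ.act (Taft.x k n m lam)) : ρ = σ := by
  have : ρ.act = σ.act := Taft.algHom_ext hg hx
  cases ρ; cases σ; congr

/-- The universal property gives the module structure. The product rule for h says that `act h` and
the image of the coproduct of h in End(A ⊗ A) agree through multiplication; both are multiplicative
in h, so the generators suffice. -/
theorem exists_hopfAction (G : A →ₐ[k] A) (X : A →ₗ[k] A) (hG : ∀ a, (G ^ n) a = a)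
    (hXm : ∀ a, (X ^ m) a = 0)
    (hX : ∀ a b, X (a * b) = X a * b + G a * X b) (hGX : ∀ a, G (X a) = lam • X (G a)) :
    ∃ ρ : HopfAction k (Taft k n m lam) A, (∀ a, ρ.act (Taft.g k n m lam) a = G a) ∧
      ∀ a, ρ.act (Taft.x k n m lam) a = X a := by
  have hX1 : X 1 = 0 := by
    have := hX 1 1
    simpa using this
  have hGn : (G.toLinearMap : Module.End k A) ^ n = 1 := by
    have : ∀ r : ℕ, (G.toLinearMap : Module.End k A) ^ r = (G ^ r).toLinearMap := by
      intro r
      induction r with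
      | zero => rfl
      | succ r ih => rw [pow_succ, ih, pow_succ]; rfl
    rw [this]
    exact LinearMap.ext hG
  let act : Taft k n m lam →ₐ[k] Module.End k A :=
    Taft.lift (G.toLinearMap : Module.End k A) X hGn (LinearMap.ext hXm) (LinearMap.ext hGX)
  have hag : act (Taft.g k n m lam) = G.toLinearMap := Taft.lift_g ..
  have hax : act (Taft.x k n m lam) = X := Taft.lift_x ..
  let Ψ : Taft k n m lam ⊗[k] Taft k n m lam →ₐ[k] Module.End k (A ⊗[k] A) :=
    (Module.endTensorEndAlgHom (A := k)).comp (Algebra.TensorProduct.map act act)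
  have hΨ : ∀ t a b, Ψ t (a ⊗ₜ b) =
      TensorProduct.map (act.toLinearMap.flip a) (act.toLinearMap.flip b) t := by
    intro t a b
    induction t with
    | zero => simp
    | tmul s t =>
      simp only [Ψ, AlgHom.comp_apply, Algebra.TensorProduct.map_tmul]
      rfl
    | add s t hs ht => simp [hs, ht]
  have hmul : ∀ h, act h ∘ₗ LinearMap.mul' k A =
      LinearMap.mul' k A ∘ₗ Ψ (Coalgebra.comul (R := k) h) := by
    intro h
    induction h using Taft.induction with
    | halg c =>
      refine TensorProduct.ext' fun a b => ?_
      rw [Bialgebra.comul_algebraMap, AlgHom.commutes, AlgHom.commutes]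
      simp
    | hg =>
      refine TensorProduct.ext' fun a b => ?_
      simp [hΨ, Taft.comul_g, hag]
    | hx =>
      refine TensorProduct.ext' fun a b => ?_
      simp [hΨ, Taft.comul_x, hag, hax, hX]
    | hmul h h' ih ih' =>
      rw [Bialgebra.comul_mul, map_mul, map_mul, Module.End.mul_eq_comp, Module.End.mul_eq_comp,
        LinearMap.comp_assoc, ih', ← LinearMap.comp_assoc, ih, LinearMap.comp_assoc]
    | hadd h h' ih ih' =>
      rw [map_add, map_add, map_add, LinearMap.add_comp, LinearMap.comp_add, ih, ih']
  refine ⟨⟨act, fun h => ?_, fun h a b => ?_⟩, fun a => ?_, fun a => ?_⟩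
  · induction h using Taft.induction with
    | halg c => simp [Algebra.algebraMap_eq_smul_one]
    | hg => simp [hag, Taft.counit_g]
    | hx => simp [hax, hX1, Taft.counit_x]
    | hmul h h' ih ih' =>
      simp only [Algebra.algebraMap_eq_smul_one] at ih ih' ⊢
      rw [map_mul, Module.End.mul_apply, ih', map_smul, ih, smul_smul, Bialgebra.counit_mul,
        mul_comm]
    | hadd h h' ih ih' => simp [ih, ih']
  · rw [← hΨ]
    exact LinearMap.congr_fun (hmul h) (a ⊗ₜ b)
  · exact LinearMap.congr_fun hag a
  · exact LinearMap.congr_fun hax a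

end General

/-! ### Actions on quantum matrices in terms of the matrix of x on the generators -/

variable {q : k} {N : ℕ}

theorem gHom_pow_gen {G : QMat k q N →ₐ[k] QMat k q N} {p : Fin N × Fin N} {c : k}
    (h : G (QMat.gen k q N p) = c • QMat.gen k q N p) (r : ℕ) :
    (G ^ r) (QMat.gen k q N p) = c ^ r • QMat.gen k q N p := by
  induction r with
  | zero => simp
  | succ r ih =>
    rw [pow_succ', AlgHom.mul_apply, ih, map_smul, h, smul_smul, pow_succ]

/-- The map a ↦ [[G a, X a], [0, a]] is multiplicative exactly when X is a skew derivation.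
Compatibility, applied to the multiplication of the algebra as a quadratic form, says that these
matrices on generators satisfy the relations. -/
theorem exists_skewDer {α : Fin N × Fin N → k} {C : Fin N × Fin N → Fin N × Fin N → k}
    (hC : Compatible (QMat k q N) q id α C) (G : QMat k q N →ₐ[k] QMat k q N)
    (hG : ∀ p, G (QMat.gen k q N p) = α p • QMat.gen k q N p) :
    ∃ X : QMat k q N →ₗ[k] QMat k q N, (∀ a b, X (a * b) = X a * b + G a * X b) ∧
      ∀ p, X (QMat.gen k q N p) = ∑ s, C p s • QMat.gen k q N s := by
  let Z : Fin N × Fin N → Matrix (Fin 2) (Fin 2) (QMat k q N) := fun p =>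
    !![G (QMat.gen k q N p), ∑ s, C p s • QMat.gen k q N s; 0, QMat.gen k q N p]
  have hZ : ∀ p t, Z p * Z t =
      !![G (QMat.gen k q N p * QMat.gen k q N t),
        twist id α C (fun p t => QMat.gen k q N p * QMat.gen k q N t) p t;
        0, QMat.gen k q N p * QMat.gen k q N t] := by
    intro p t
    simp only [Z, Matrix.mul_fin_two, twist, hG, map_mul, id]
    simp [Finset.sum_mul, Finset.mul_sum, Finset.smul_sum, add_comm, smul_smul, mul_comm]
  have hq := QMat.isQuadratic_mul q N
  have ht := hC _ hq
  let F : QMat k q N →ₐ[k] Matrix (Fin 2) (Fin 2) (QMat k q N) :=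
    QMat.lift (fun i j => Z (i, j))
      (fun i l j h => by
        rw [hZ, hZ, ht.col i l j h, hq.col i l j h, map_smul]; simp)
      (fun i j r h => by
        rw [hZ, hZ, ht.row i j r h, hq.row i j r h, map_smul]; simp)
      (fun i j l r h h' => by
        rw [hZ, hZ, ht.anti i j l r h h', hq.anti i j l r h h'])
      (fun i j l r h h' => by
        rw [hZ, hZ, hZ, ht.diag i j l r h h', hq.diag i j l r h h', map_add, map_smul]; simp)
  have hF : ∀ p, F (QMat.gen k q N p) = Z p := fun p => QMat.lift_Y ..
  have hF' : ∀ a, F a = !![G a, F a 0 1; 0, a] := by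
    intro a
    induction a using QMat.induction with
    | halg c =>
      rw [AlgHom.commutes, AlgHom.commutes]
      ext i j; fin_cases i <;> fin_cases j <;> simp [Matrix.algebraMap_matrix_apply]
    | hY i j =>
      have := hF (i, j)
      simp only [QMat.gen] at this
      rw [this]; rfl
    | hmul a b ha hb =>
      rw [map_mul, ha, hb]
      ext i j; fin_cases i <;> fin_cases j <;> simp
    | hadd a b ha hb =>
      rw [map_add, ha, hb]
      ext i j; fin_cases i <;> fin_cases j <;> simp
  refine ⟨(Matrix.entryLinearMap k (QMat k q N) 0 1) ∘ₗ F.toLinearMap, fun a b => ?_,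
    fun p => ?_⟩
  · simp only [LinearMap.comp_apply, AlgHom.toLinearMap_apply, Matrix.entryLinearMap_apply]
    rw [map_mul, Matrix.mul_apply, Fin.sum_univ_two, hF' a, hF' b]
    simp [add_comm]
  · simp [hF, Z]

variable [NeZero n] [NeZero m] [Fact (IsPrimitiveRoot lam m)]

theorem exists_action_of_compatible {α : Fin N × Fin N → k}
    {C : Fin N × Fin N → Fin N × Fin N → k} (hC : Compatible (QMat k q N) q id α C)
    (a b : Fin N → kˣ) (hα : ∀ p, α p = a p.1 * b p.2) (hαn : ∀ p, α p ^ n = 1)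
    (hlam : ∀ p s, C p s ≠ 0 → α s = lam * α p) (hCC : ∀ p s t, C p s * C s t = 0) (hm : 2 ≤ m) :
    ∃ ρ : HopfAction k (Taft k n m lam) (QMat k q N),
      ∀ p, ρ.act (Taft.g k n m lam) (QMat.gen k q N p) = α p • QMat.gen k q N p ∧
        ρ.act (Taft.x k n m lam) (QMat.gen k q N p) = ∑ s, C p s • QMat.gen k q N s := by
  have hG : ∀ p, QMat.scaleHom q a b (QMat.gen k q N p) = α p • QMat.gen k q N p := by
    intro p
    rw [hα]
    exact QMat.scaleHom_Y ..
  obtain ⟨X, hX, hXg⟩ := exists_skewDer hC _ hG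
  have hX1 : X 1 = 0 := by simpa using hX 1 1
  have hXc : ∀ c : k, X (algebraMap k _ c) = 0 := fun c => by
    rw [Algebra.algebraMap_eq_smul_one, map_smul, hX1, smul_zero]
  have hGX : ∀ y, QMat.scaleHom q a b (X y) = lam • X (QMat.scaleHom q a b y) := by
    intro y
    induction y using QMat.induction with
    | halg c => simp [hXc]
    | hY i j =>
      change QMat.scaleHom q a b (X (QMat.gen k q N (i, j))) =
        lam • X (QMat.scaleHom q a b (QMat.gen k q N (i, j)))
      rw [hG, map_smul, hXg, map_sum, smul_smul, Finset.smul_sum]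
      refine Finset.sum_congr rfl fun s _ => ?_
      by_cases h : C (i, j) s = 0
      · simp [h]
      · rw [map_smul, hG, hlam _ _ h, smul_smul, smul_smul, mul_comm]
    | hmul y z hy hz =>
      rw [hX, map_add, map_mul, map_mul, map_mul, hX, hy, hz]
      simp
    | hadd y z hy hz => simp [hy, hz]
  have hm0 : m ≠ 0 := by omega
  obtain ⟨ρ, h1, h2⟩ := exists_hopfAction (n := n) (m := m) (QMat.scaleHom q a b) X
    (fun y => by
      have : QMat.scaleHom q a b ^ n = 1 := QMat.algHom_ext fun i j => by
        have := gHom_pow_gen (hG (i, j)) n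
        rw [hαn, one_smul] at this
        exact this
      rw [this]; rfl)
    (fun y => by
      induction y using QMat.induction with
      | halg c =>
        obtain ⟨r, rfl⟩ := Nat.exists_eq_succ_of_ne_zero hm0
        simp [pow_succ, hXc]
      | hY i j =>
        change (X ^ m) (QMat.gen k q N (i, j)) = 0
        -- Already X² vanishes on the generators, because no two arrows of C are composable.
        obtain ⟨r, rfl⟩ := Nat.exists_eq_add_of_le' hm
        rw [pow_add, Module.End.mul_apply, pow_two, Module.End.mul_apply, hXg, map_sum,
          Finset.sum_eq_zero fun s _ => ?_, map_zero]
        rw [map_smul, hXg, Finset.smul_sum, Finset.sum_eq_zero fun t _ => ?_]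
        rw [smul_smul, hCC, zero_smul]
      | hmul y z hy hz =>
        rw [skewDer_pow_mul Fact.out hm0 hX hGX, hy, hz, zero_mul, mul_zero, add_zero]
      | hadd y z hy hz => rw [map_add, hy, hz, add_zero])
    hX hGX
  exact ⟨ρ, fun p => ⟨by rw [h1, hG], by rw [h2, hXg]⟩⟩

theorem HopfAction.ext_gen {ρ σ : HopfAction k (Taft k n m lam) (QMat k q N)}
    (hg : ∀ p, ρ.act (Taft.g k n m lam) (QMat.gen k q N p) =
      σ.act (Taft.g k n m lam) (QMat.gen k q N p))
    (hx : ∀ p, ρ.act (Taft.x k n m lam) (QMat.gen k q N p) =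
      σ.act (Taft.x k n m lam) (QMat.gen k q N p)) : ρ = σ := by
  have h : ρ.gHom = σ.gHom := QMat.algHom_ext fun i j => hg (i, j)
  have hg' : ρ.act (Taft.g k n m lam) = σ.act (Taft.g k n m lam) :=
    LinearMap.ext fun a => AlgHom.congr_fun h a
  refine HopfAction.ext_gx hg' (LinearMap.ext fun a => ?_)
  induction a using QMat.induction with
  | halg c => simp only [Algebra.algebraMap_eq_smul_one, map_smul, HopfAction.x_one]
  | hY i j => exact hx (i, j)
  | hmul a b ha hb => rw [ρ.x_mul, σ.x_mul, ha, hb, hg']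
  | hadd a b ha hb => rw [map_add, map_add, ha, hb]

theorem HopfAction.x_eq_zero {ρ : HopfAction k (Taft k n m lam) (QMat k q N)}
    (hx : ∀ p, ρ.act (Taft.x k n m lam) (QMat.gen k q N p) = 0) :
    ρ.act (Taft.x k n m lam) = 0 := by
  refine LinearMap.ext fun a => ?_
  induction a using QMat.induction with
  | halg c => simp only [Algebra.algebraMap_eq_smul_one, map_smul, HopfAction.x_one,
      LinearMap.zero_apply]
  | hY i j => exact hx (i, j)
  | hmul a b ha hb => rw [ρ.x_mul, ha, hb]; simp
  | hadd a b ha hb => rw [map_add, map_add, ha, hb]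

/-- The functional attached to β, composed with the operator of x, takes the value of the twisted
form on a product of two generators, hence respects the relations. -/
theorem HopfAction.compatible (ρ : HopfAction k (Taft k n m lam) (QMat k q N))
    {π : Fin N × Fin N → Fin N × Fin N} {α : Fin N × Fin N → k}
    {C : Fin N × Fin N → Fin N × Fin N → k}
    (hg : ∀ p, ρ.act (Taft.g k n m lam) (QMat.gen k q N p) = α p • QMat.gen k q N (π p))
    (hx : ∀ p, ρ.act (Taft.x k n m lam) (QMat.gen k q N p) = ∑ s, C p s • QMat.gen k q N s) :
    Compatible k q π α C := by
  intro β hβ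
  obtain ⟨f, -, hf⟩ := QMat.exists_functional hβ
  let F : QMat k q N →ₗ[k] k :=
    LinearMap.snd k _ _ ∘ₗ LinearMap.snd k _ _ ∘ₗ f ∘ₗ ρ.act (Taft.x k n m lam)
  have hF : ∀ p t, twist π α C β p t = F (QMat.gen k q N p * QMat.gen k q N t) := by
    intro p t
    simp [F, twist, ρ.x_mul, hg, hx, Finset.sum_mul, Finset.mul_sum, hf, Prod.snd_sum,
      mul_left_comm]
  have hq := QMat.isQuadratic_mul q N
  constructor
  · intro i l j h
    rw [hF, hF, hq.col i l j h, map_smul]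
  · intro i j r h
    rw [hF, hF, hq.row i j r h, map_smul]
  · intro i j l r h h'
    rw [hF, hF, hq.anti i j l r h h']
  · intro i j l r h h'
    rw [hF, hF, hF, hq.diag i j l r h h', map_add, map_smul]

end Actions

/-! ### Classification of homogeneous skew derivations -/

section Classification

variable {k : Type u} [Field k] {q lam : k} {N : ℕ}

/-! ### Consequences of single relations for a component moving column j to column r -/

section Row

variable {α : Fin N × Fin N → k} {c : Fin N → k} {j r : Fin N}

/-- Here c i is the coefficient of Y_ij → Y_ir. Each lemma below evaluates one relation of this form
at a well chosen β: the rows i and l are compared within the columns j and r, or against a third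
column b. -/
theorem isQuadratic_of_row (H : Compatible k q id α
      fun p s => if s = (p.1, r) then (if p.2 = j then c p.1 else 0) else 0)
    {β : Fin N × Fin N → Fin N × Fin N → k} (hβ : IsQuadratic q β) :
    IsQuadratic q fun p t => (if p.2 = j then c p.1 else 0) * β (p.1, r) t +
      α p * (if t.2 = j then c t.1 else 0) * β p (t.1, r) := by
  convert H β hβ using 3 with p t
  exact (twist_monomial id α (fun p => if p.2 = j then c p.1 else 0) (fun p => (p.1, r)) β p t).symm

variable (hq0 : q ≠ 0) (hjr : j < r)
  (H : Compatible k q id α fun p s => if s = (p.1, r) then (if p.2 = j then c p.1 else 0) else 0)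

include hjr H

theorem row_source_source {i l : Fin N} (hil : i < l) (x y : k) :
    c i * y + α (i, j) * c l * x =
      q * (c l * (x - (q - q⁻¹) * y) + α (l, j) * c i * y) := by
  obtain ⟨β, hβ, h1, h2, h3, h4⟩ := exists_isQuadratic_square q hil hjr x y
  simpa [h1, h2, h3, h4] using (isQuadratic_of_row H hβ).col i l j hil

include hq0

theorem row_target (i : Fin N) : c i = q * α (i, r) * c i := by
  obtain ⟨β, hβ, hz⟩ := exists_isQuadratic_ne_zero hq0 (i, r) (i, r)
  have := (isQuadratic_of_row H hβ).row i j r hjr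
  simp only [if_true, if_neg hjr.ne', mul_zero, zero_mul, add_zero, zero_add, smul_eq_mul] at this
  exact mul_right_cancel₀ hz (by linear_combination this)

theorem row_source_target_of_lt {i l : Fin N} (hil : i < l) :
    c i * q = α (l, r) * c i + (q - q⁻¹) * α (i, r) * c l * q := by
  obtain ⟨β, hβ, hz⟩ := exists_isQuadratic_ne_zero hq0 (l, r) (i, r)
  have := (isQuadratic_of_row H hβ).diag i j l r hil hjr
  simp only [if_true, if_neg hjr.ne', mul_zero, zero_mul, add_zero, zero_add, smul_eq_mul,
    hβ.col i l r hil] at this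
  exact mul_right_cancel₀ hz (by linear_combination this)

theorem row_target_source_of_lt {i l : Fin N} (hil : i < l) : α (i, r) * c l * q = c l := by
  obtain ⟨β, hβ, hz⟩ := exists_isQuadratic_ne_zero hq0 (l, r) (i, r)
  have := (isQuadratic_of_row H hβ).anti i r l j hil hjr
  simp only [if_true, if_neg hjr.ne', mul_zero, zero_mul, add_zero, zero_add, smul_eq_mul,
    hβ.col i l r hil] at this
  exact mul_right_cancel₀ hz (by linear_combination this)

omit hjr in
theorem row_between (i : Fin N) {b : Fin N} (hjb : j < b) (hbr : b < r) :
    c i = q ^ 2 * α (i, b) * c i := by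
  obtain ⟨β, hβ, hz⟩ := exists_isQuadratic_ne_zero hq0 (i, r) (i, b)
  have := (isQuadratic_of_row H hβ).row i j b hjb
  simp only [if_true, if_neg hjb.ne', mul_zero, zero_mul, add_zero, zero_add, smul_eq_mul,
    hβ.row i b r hbr] at this
  exact mul_right_cancel₀ hz (by linear_combination this)

theorem row_after (i : Fin N) {b : Fin N} (hrb : r < b) : c i = α (i, b) * c i := by
  obtain ⟨β, hβ, hz⟩ := exists_isQuadratic_ne_zero hq0 (i, b) (i, r)
  have := (isQuadratic_of_row H hβ).row i j b (hjr.trans hrb)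
  simp only [if_true, if_neg (hjr.trans hrb).ne', mul_zero, zero_mul, add_zero, zero_add,
    smul_eq_mul, hβ.row i r b hrb] at this
  exact mul_right_cancel₀ hq0 (mul_right_cancel₀ hz (by linear_combination this))

theorem row_before (i : Fin N) {b : Fin N} (hbj : b < j) : c i = α (i, b) * c i := by
  obtain ⟨β, hβ, hz⟩ := exists_isQuadratic_ne_zero hq0 (i, r) (i, b)
  have := (isQuadratic_of_row H hβ).row i b j hbj
  simp only [if_true, if_neg hbj.ne, mul_zero, zero_mul, add_zero, zero_add, smul_eq_mul,
    hβ.row i b r (hbj.trans hjr)] at this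
  exact mul_right_cancel₀ hq0 (mul_right_cancel₀ hz (by linear_combination -this))

omit hq0

omit hjr in
theorem row_between_diag {i l b : Fin N} (hil : i < l) (hjb : j < b) (hbr : b < r) (x y : k) :
    c i * y = α (l, b) * c i * y + (q - q⁻¹) * α (i, b) * c l * x := by
  obtain ⟨β, hβ, h1, h2, h3, h4⟩ := exists_isQuadratic_square q hil hbr x y
  have := (isQuadratic_of_row H hβ).diag i j l b hil hjb
  simp only [if_true, if_neg hjb.ne', mul_zero, zero_mul, add_zero, zero_add, smul_eq_mul, h1, h3,
    h4] at this
  linear_combination this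

theorem row_after_diag {i l b : Fin N} (hil : i < l) (hrb : r < b) (x y : k) :
    c i * x = α (l, b) * c i * (x - (q - q⁻¹) * y) + (q - q⁻¹) * α (i, b) * c l * y := by
  obtain ⟨β, hβ, h1, h2, h3, h4⟩ := exists_isQuadratic_square q hil hrb x y
  have := (isQuadratic_of_row H hβ).diag i j l b hil (hjr.trans hrb)
  simp only [if_true, if_neg (hjr.trans hrb).ne', mul_zero, zero_mul, add_zero, zero_add,
    smul_eq_mul, h1, h2, h3] at this
  linear_combination this

theorem row_before_diag {i l b : Fin N} (hil : i < l) (hbj : b < j) (x y : k) :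
    α (i, b) * c l * x = c l * (x - (q - q⁻¹) * y) + (q - q⁻¹) * c i * y := by
  obtain ⟨β, hβ, h1, h2, h3, h4⟩ := exists_isQuadratic_square q hil (hbj.trans hjr) x y
  have := (isQuadratic_of_row H hβ).diag i b l j hil hbj
  simp only [if_true, if_neg hbj.ne, mul_zero, zero_mul, add_zero, zero_add,
    smul_eq_mul, h1, h2, h3] at this
  linear_combination this

end Row

theorem sub_inv_ne_zero (hq0 : q ≠ 0) (hq2 : q ^ 2 ≠ 1) : q - q⁻¹ ≠ 0 := by
  intro h
  refine hq2 ?_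
  have : q * (q - q⁻¹) = 0 := by rw [h, mul_zero]
  rw [mul_sub, mul_inv_cancel₀ hq0] at this
  linear_combination this

/-- The hypothesis on α is imposed in every row, including those with c i = 0; this is what ties lam
to q in the second case. -/
theorem classify_row_right [NeZero N] (hN : 1 < N) (hq0 : q ≠ 0) (hq2 : q ^ 2 ≠ 1)
    (hlam : lam ^ 2 ≠ 1)
    {α : Fin N × Fin N → k} (hα0 : ∀ p, α p ≠ 0) {c : Fin N → k} {j r : Fin N} (hjr : j < r)
    (hb : ∀ i, α (i, r) = lam * α (i, j))
    (H : Compatible k q id α fun p s => if s = (p.1, r) then (if p.2 = j then c p.1 else 0) else 0)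
    {i₀ : Fin N} (hc : c i₀ ≠ 0) :
    (∃ h : (j : ℕ) + 1 = r, lam = (q ^ 2)⁻¹ ∧
      (∀ i y, α (i, y) = (Family.colRight j r h).gWeight q i y) ∧ ∀ i, c i = c i₀) ∨
    (lam = q ^ 2 ∧ j = 0 ∧ r = Fin.rev 0 ∧
      (∀ i y, α (i, y) = Family.firstToTopRight.gWeight q i y) ∧ ∀ i, i ≠ 0 → c i = 0) := by
  have hqq := sub_inv_ne_zero hq0 hq2
  have hinv : q * q⁻¹ = 1 := mul_inv_cancel₀ hq0
  have hlast : ∀ i : Fin N, i ≠ 0 → 0 < i := fun i hi => Fin.pos_iff_ne_zero.mpr hi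
  -- If c l ≠ 0, the two mixed source-target relations fix α (i, r) = α (l, r) = q⁻¹ and leave (q -
  -- q⁻¹) c i = (q - q⁻¹) c l. So the nonzero coefficients are equal and form an initial segment.
  have hmono : ∀ i l, i < l → c l ≠ 0 → c i = c l := by
    intro i l hil hl
    have h1 := row_target_source_of_lt hq0 hjr H hil
    have h2 := row_target hq0 hjr H l
    have h3 := row_source_target_of_lt hq0 hjr H hil
    have e1 : α (i, r) * q = 1 := mul_right_cancel₀ hl (by linear_combination h1)
    have e2 : q * α (l, r) = 1 := mul_right_cancel₀ hl (by linear_combination -h2)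
    refine mul_left_cancel₀ hqq ?_
    refine mul_left_cancel₀ hq0 ?_
    linear_combination q * h3 + c i * e2 + q * (q - q⁻¹) * c l * e1 - c i * hinv
  have hc0 : c 0 = c i₀ := by
    rcases eq_or_ne i₀ 0 with rfl | h
    · rfl
    · exact hmono 0 i₀ (hlast _ h) hc
  have hc0' : c 0 ≠ 0 := hc0 ▸ hc
  have hone : (⟨1, hN⟩ : Fin N) ≠ 0 := by
    intro h; simpa using congrArg Fin.val h
  have htarget : ∀ i, c i ≠ 0 → α (i, r) = q⁻¹ := fun i hi => by
    have h := row_target hq0 hjr H i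
    refine eq_inv_of_mul_eq_one_right (mul_right_cancel₀ hi ?_)
    linear_combination -h
  have hsource : ∀ i l, i < l → c l ≠ 0 → α (i, j) = q := fun i l hil hl => by
    have h := row_source_source hjr H hil 1 0
    exact mul_right_cancel₀ hl (by linear_combination h)
  by_cases hall : ∀ i, c i ≠ 0
  · left
    have hceq : ∀ i, c i = c 0 := fun i => by
      rcases eq_or_ne i 0 with rfl | h
      · rfl
      · exact (hmono 0 i (hlast i h) (hall i)).symm
    have hsrc : ∀ i, α (i, j) = q := fun i => by
      rcases eq_or_ne i 0 with rfl | h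
      · exact hsource _ _ (hlast _ hone) (hall _)
      · have h := row_source_source hjr H (hlast i h) 0 1
        rw [hceq i] at h
        refine mul_left_cancel₀ hq0 (mul_left_cancel₀ hc0' ?_)
        linear_combination -h - c 0 * hinv
    have hadj : (j : ℕ) + 1 = r := by
      by_contra hne
      have hjr' : (j : ℕ) < r := hjr
      have hb1 : j < (⟨j + 1, by omega⟩ : Fin N) := Nat.lt_succ_self _
      have hb2 : (⟨j + 1, by omega⟩ : Fin N) < r := by
        change (j : ℕ) + 1 < r; omega
      -- For a column strictly between j and r, taking x = 1, y = 0 in rows 0 and 1 leaves the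
      -- impossible equation (q - q⁻¹) α (0, b) c 1 = 0.
      have h := row_between_diag H (hlast _ hone) hb1 hb2 1 0
      simp [hqq, hα0, hall] at h
    refine ⟨hadj, ?_, fun i y => ?_, fun i => (hceq i).trans hc0⟩
    · have h := hb 0
      rw [htarget 0 hc0', hsrc 0] at h
      refine eq_inv_of_mul_eq_one_left ?_
      linear_combination -q * h + hinv
    · simp only [Family.gWeight]
      split_ifs with h1 h2
      · rw [h1, hsrc]
      · rw [h2, htarget i (hall i)]
      · have : y < j ∨ r < y := by
          rcases lt_trichotomy y j with h | h | h
          · exact Or.inl h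
          · exact absurd h h1
          · refine Or.inr (lt_of_le_of_ne ?_ (Ne.symm h2))
            change (r : ℕ) ≤ y
            have : (j : ℕ) < y := h
            omega
        have h : c i = α (i, y) * c i := this.elim (row_before hq0 hjr H i) (row_after hq0 hjr H i)
        exact (mul_right_cancel₀ (hall i) (by linear_combination h)).symm
  · right
    push Not at hall
    obtain ⟨l₁, hl₁⟩ := hall
    have hl₁0 : 0 < l₁ := hlast _ (by rintro rfl; exact hc0' hl₁)
    have hzsrc : ∀ l, 0 < l → c l = 0 → α (l, j) = q⁻¹ := fun l hl hcl => by
      have h := row_source_source hjr H hl 0 1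
      rw [hcl] at h
      refine eq_inv_of_mul_eq_one_right (mul_right_cancel₀ hc0' ?_)
      linear_combination -h
    have hztgt : ∀ l, 0 < l → c l = 0 → α (l, r) = q := fun l hl hcl => by
      have h := row_source_target_of_lt hq0 hjr H hl
      rw [hcl] at h
      exact mul_right_cancel₀ hc0' (by linear_combination -h)
    have hlq : lam = q ^ 2 := by
      have h := hb l₁
      rw [hzsrc _ hl₁0 hl₁, hztgt _ hl₁0 hl₁] at h
      linear_combination -q * h - lam * hinv
    -- A nonzero coefficient below the first row would give lam = q⁻² from row 0, while the
    -- vanishing c l₁ gives lam = q²; together these contradict lam² ≠ 1.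
    have hzero : ∀ l, l ≠ 0 → c l = 0 := by
      intro l hl
      by_contra hcl
      have h := hb 0
      rw [hsource 0 l (hlast l hl) hcl, htarget 0 hc0', hlq] at h
      refine hlam ?_
      rw [hlq]
      linear_combination -q * h + hinv
    have h1 := hzero _ hone
    -- Since c 1 = 0, a column before j or after r leaves a lone term, a nonzero multiple of (q -
    -- q⁻¹) c 0; so j is first and r is last.
    have hj : j = 0 := by
      by_contra hj
      have h := row_before_diag hjr H (hlast _ hone) (hlast _ hj) 0 1
      rw [h1] at h
      simp [hqq, hc0'] at h
    have hr : r = Fin.rev 0 := by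
      by_contra hr
      have hr' : r < Fin.rev 0 := lt_of_le_of_ne (Fin.le_rev_iff.mpr (Fin.zero_le _)) hr
      have h2 := row_after_diag hjr H (hlast _ hone) hr' 0 1
      rw [h1] at h2
      simp [hc0', hα0] at h2
      exact hqq (by linear_combination -h2)
    refine ⟨hlq, hj, hr, fun i y => ?_, hzero⟩
    subst hj
    subst hr
    have hr0 : (Fin.rev 0 : Fin N) ≠ 0 := hjr.ne'
    have hfr := htarget 0 hc0'
    have hfs : α (0, 0) = (q ^ 2)⁻¹ * q⁻¹ := by
      have h := hb 0
      rw [hfr, hlq] at h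
      field_simp at h ⊢
      linear_combination -h
    simp only [Family.gWeight]
    rcases eq_or_ne i 0 with rfl | hi
    · rw [if_pos rfl]
      split_ifs with hy hy'
      · rw [hy, hfs]
      · rw [hy', hfr]; field_simp
      · have h := row_between hq0 H 0 (hlast y hy)
          (lt_of_le_of_ne (Fin.le_rev_iff.mpr (Fin.zero_le _)) hy')
        rw [mul_one]
        refine eq_inv_of_mul_eq_one_right (mul_right_cancel₀ hc0' ?_)
        linear_combination -h
    · rw [if_neg hi, one_mul]
      split_ifs with hy hy'
      · rw [hy, hzsrc i (hlast i hi) (hzero i hi)]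
      · rw [hy', hztgt i (hlast i hi) (hzero i hi)]
      · have h := row_between_diag H (hlast i hi) (hlast y hy)
          (lt_of_le_of_ne (Fin.le_rev_iff.mpr (Fin.zero_le _)) hy') 0 1
        exact mul_right_cancel₀ hc0' (by linear_combination -h)

/-! ### Skew derivations changing both the row and the column -/

theorem isQuadratic_of_single {α : Fin N × Fin N → k} {c : k} {p₀ s₀ : Fin N × Fin N}
    (H : Compatible k q id α fun p s => if s = s₀ then (if p = p₀ then c else 0) else 0)
    {β : Fin N × Fin N → Fin N × Fin N → k} (hβ : IsQuadratic q β) :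
    IsQuadratic q fun p t => (if p = p₀ then c else 0) * β s₀ t +
      α p * (if t = p₀ then c else 0) * β p s₀ := by
  convert H β hβ using 3 with p t
  exact (twist_monomial id α (fun p => if p = p₀ then c else 0) (fun _ => s₀) β p t).symm

/-- The image Y_lr of the first corner would have to q-commute with some generator in rows and
columns different from l and r, where a correction term with q - q⁻¹ prevents it. -/
theorem not_compatible_single_first (hN : 3 ≤ N) (hq0 : q ≠ 0) (hq2 : q ^ 2 ≠ 1)
    {α : Fin N × Fin N → k} (hα0 : ∀ p, α p ≠ 0) {c : k} (hc : c ≠ 0) {i j l r : Fin N}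
    (hi : (i : ℕ) = 0) (hj : (j : ℕ) = 0) (hil : i ≠ l) (hjr : j ≠ r)
    (H : Compatible k q id α
      fun p s => if s = (l, r) then (if p = (i, j) then c else 0) else 0) : False := by
  have hqq := sub_inv_ne_zero hq0 hq2
  have hil' : i < l := by
    have : (i : ℕ) ≠ l := fun h => hil (Fin.ext h)
    change (i : ℕ) < l; omega
  have hjr' : j < r := by
    have : (j : ℕ) ≠ r := fun h => hjr (Fin.ext h)
    change (j : ℕ) < r; omega
  have hi1 : i < (⟨1, by omega⟩ : Fin N) := by change (i : ℕ) < 1; omega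
  have hj1 : j < (⟨1, by omega⟩ : Fin N) := by change (j : ℕ) < 1; omega
  rcases lt_or_ge 1 (r : ℕ) with hr | hr
  · have hr1 : (⟨1, by omega⟩ : Fin N) < r := hr
    -- With x = 0, y = 1 the form vanishes on Y_01 Y_lr but not on Y_lr Y_01, whereas the row
    -- relation makes these values proportional.
    obtain ⟨β, hβ, h1, h2, h3, h4⟩ := exists_isQuadratic_square q hil' hr1 0 1
    have := (isQuadratic_of_single H hβ).row i j _ hj1
    simp [h1, h2, hj1.ne', hc] at this
    exact hqq (by linear_combination -this)
  rcases lt_or_ge 1 (l : ℕ) with hl | hl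
  · have hl1 : (⟨1, by omega⟩ : Fin N) < l := hl
    obtain ⟨β, hβ, h1, h2, h3, h4⟩ := exists_isQuadratic_square q hl1 hjr' 0 1
    have := (isQuadratic_of_single H hβ).col i _ j hi1
    simp [h1, h2, hi1.ne', hc] at this
    exact hqq (by linear_combination -this)
  -- What remains is l = r = 1, counted from 0. The generator Y_22, available because N ≥ 3, plays
  -- the same role.
  have hl2 : l < (⟨2, by omega⟩ : Fin N) := by change (l : ℕ) < 2; omega
  have hr2 : r < (⟨2, by omega⟩ : Fin N) := by change (r : ℕ) < 2; omega
  obtain ⟨β, hβ, h1, h2, h3, h4⟩ := exists_isQuadratic_square q hl2 hr2 0 1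
  have := (isQuadratic_of_single H hβ).diag i j _ _ (hil'.trans hl2) (hjr'.trans hr2)
  simp [h1, h2, (hil'.trans hl2).ne', (hjr'.trans hr2).ne', hc, hα0] at this
  exact hqq (by linear_combination -this)

/-- In the diagonal relation of a minor with (i, j) on its antidiagonal, this generator occurs only
in the term with coefficient q - q⁻¹, and its twisted contribution cannot vanish for every β. So a
source must be the upper left or the lower right corner. -/
theorem corner_of_compatible_single (hq0 : q ≠ 0) (hq2 : q ^ 2 ≠ 1)
    {α : Fin N × Fin N → k} (hα0 : ∀ p, α p ≠ 0) {c : k} (hc : c ≠ 0) {i j : Fin N}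
    {s : Fin N × Fin N} (H : Compatible k q id α
      fun p t => if t = s then (if p = (i, j) then c else 0) else 0) {a b : Fin N} :
    ¬ (i < a ∧ b < j) ∧ ¬ (a < i ∧ j < b) := by
  have hqq := sub_inv_ne_zero hq0 hq2
  constructor
  · rintro ⟨ha, hb⟩
    obtain ⟨β, hβ, h0⟩ := exists_isQuadratic_ne_zero hq0 s (a, b)
    have := (isQuadratic_of_single H hβ).diag i b a j ha hb
    simp [ha.ne', hb.ne, hqq, hc, h0] at this
  · rintro ⟨ha, hb⟩
    obtain ⟨β, hβ, h0⟩ := exists_isQuadratic_ne_zero hq0 (a, b) s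
    have := (isQuadratic_of_single H hβ).diag a j i b ha hb
    simp [ha.ne, hb.ne', hqq, hc, h0, hα0] at this

end Classification

/-! ### Symmetries of the families -/

theorem zero_ne_rev_zero {N : ℕ} [NeZero N] (hN : 1 < N) : (0 : Fin N) ≠ Fin.rev 0 := by
  intro h
  have := congrArg Fin.val h
  rw [Fin.val_rev, Fin.val_zero] at this
  omega

namespace Family

variable {k : Type u} [Field k] {N : ℕ}

/-- The family obtained by exchanging rows and columns. -/
def transpose : Family N → Family N
  | colLeft b b' h => rowUp b b' h
  | rowUp a a' h => colLeft a a' h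
  | firstToTopRight => firstToBottomLeft
  | firstToBottomLeft => firstToTopRight
  | colRight b b' h => rowDown b b' h
  | rowDown a a' h => colRight a a' h
  | lastToTopRight => lastToBottomLeft
  | lastToBottomLeft => lastToTopRight

/-- The family obtained by reversing the order of rows and columns. -/
def rev : Family N → Family N
  | colLeft b b' h => colRight b.rev b'.rev (by rw [Fin.val_rev, Fin.val_rev]; omega)
  | rowUp a a' h => rowDown a.rev a'.rev (by rw [Fin.val_rev, Fin.val_rev]; omega)
  | firstToTopRight => lastToBottomLeft
  | firstToBottomLeft => lastToTopRight
  | colRight b b' h => colLeft b.rev b'.rev (by rw [Fin.val_rev, Fin.val_rev]; omega)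
  | rowDown a a' h => rowUp a.rev a'.rev (by rw [Fin.val_rev, Fin.val_rev]; omega)
  | lastToTopRight => firstToBottomLeft
  | lastToBottomLeft => firstToTopRight

theorem transpose_transpose (f : Family N) : f.transpose.transpose = f := by cases f <;> rfl

theorem rev_rev (f : Family N) : f.rev.rev = f := by cases f <;> simp [rev]

theorem transpose_injective : Function.Injective (transpose : Family N → Family N) :=
  Function.LeftInverse.injective transpose_transpose

theorem rev_injective : Function.Injective (rev : Family N → Family N) :=
  Function.LeftInverse.injective rev_rev

theorem lamValue_transpose (q : k) (f : Family N) : f.transpose.lamValue q = f.lamValue q := by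
  cases f <;> rfl

theorem lamValue_rev (q : k) (f : Family N) : f.rev.lamValue q⁻¹ = f.lamValue q := by
  cases f <;> simp [rev, lamValue]

variable [NeZero N]

/-- The generators on which `x` does not vanish. -/
def Src : Family N → Fin N × Fin N → Prop
  | colLeft b _ _, p | colRight b _ _, p => p.2 = b
  | rowUp a _ _, p | rowDown a _ _, p => p.1 = a
  | firstToTopRight, p | firstToBottomLeft, p => p.1 = 0 ∧ p.2 = 0
  | lastToTopRight, p | lastToBottomLeft, p => p.1 = Fin.rev 0 ∧ p.2 = Fin.rev 0

instance (f : Family N) : DecidablePred f.Src := fun p => by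
  cases f <;> unfold Src <;> infer_instance

/-- The generator to which `x` moves a given one. -/
def arrow : Family N → Fin N × Fin N → Fin N × Fin N
  | colLeft _ b' _, p | colRight _ b' _, p => (p.1, b')
  | rowUp _ a' _, p | rowDown _ a' _, p => (a', p.2)
  | firstToTopRight, _ | lastToTopRight, _ => (0, Fin.rev 0)
  | firstToBottomLeft, _ | lastToBottomLeft, _ => (Fin.rev 0, 0)

/-- The matrix of `x` on the generators. -/
def coeff (f : Family N) (d : k) (p s : Fin N × Fin N) : k :=
  if s = f.arrow p then (if f.Src p then d else 0) else 0

theorem sum_coeff_smul {M : Type*} [AddCommGroup M] [Module k M] (f : Family N) (d : k)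
    (p : Fin N × Fin N) (v : Fin N × Fin N → M) :
    ∑ s, f.coeff d p s • v s = (if f.Src p then d else 0) • v (f.arrow p) := by
  rw [Finset.sum_eq_single (f.arrow p) (fun s _ hs => by rw [coeff, if_neg hs, zero_smul])
    (by simp), coeff, if_pos rfl]

theorem xValue_eq (q d : k) (f : Family N) (i j : Fin N) :
    f.xValue q d i j = ∑ s, f.coeff d (i, j) s • QMat.gen k q N s := by
  rw [sum_coeff_smul]
  by_cases h : f.Src (i, j)
  · rw [if_pos h]
    cases f <;> simp only [Src] at h <;> simp [xValue, arrow, QMat.gen, h]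
  · rw [if_neg h, zero_smul]
    cases f <;> simp only [Src] at h <;> simp [xValue, h]

theorem gWeight_transpose (q : k) (f : Family N) (i j : Fin N) :
    f.transpose.gWeight q i j = f.gWeight q j i := by
  cases f <;> rfl

theorem src_transpose (f : Family N) (p : Fin N × Fin N) :
    f.transpose.Src p ↔ f.Src p.swap := by
  cases f <;> simp [transpose, Src, and_comm]

theorem arrow_transpose (f : Family N) (p : Fin N × Fin N) :
    f.transpose.arrow p = (f.arrow p.swap).swap := by
  cases f <;> rfl

theorem gWeight_rev (hN : 1 < N) (q : k) (f : Family N) (i j : Fin N) :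
    f.rev.gWeight q⁻¹ i j = f.gWeight q i.rev j.rev := by
  have h0 := zero_ne_rev_zero hN
  -- Reversal permutes the two tests in the nested conditionals; they are mutually exclusive since y
  -- ≠ z.
  have key : ∀ (x y z : Fin N) (s t w : k), y ≠ z → (if x = z.rev then s else
      if x = y.rev then t else w) = if x.rev = y then t else if x.rev = z then s else w := by
    intro x y z s t w hyz
    simp only [Fin.rev_eq_iff]
    by_cases h1 : x = y.rev
    · subst h1
      simp [hyz]
    · simp [h1]
  have hne : ∀ {b b' : Fin N}, (b' : ℕ) + 1 = b → b ≠ b' := by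
    rintro b b' h rfl; omega
  have key0 : ∀ (x : Fin N) (s w : k), (if x = Fin.rev 0 then s else w) =
      if x.rev = 0 then s else w := by
    intro x s w
    simp [Fin.rev_eq_iff]
  have key1 : ∀ (x : Fin N) (s w : k), (if x = 0 then s else w) =
      if x.rev = Fin.rev 0 then s else w := by
    intro x s w
    simp
  cases f with
  | colLeft b b' h => simp only [rev, gWeight, inv_inv, key _ _ _ _ _ _ (hne h).symm]
  | rowUp b b' h => simp only [rev, gWeight, inv_inv, key _ _ _ _ _ _ (hne h).symm]
  | colRight b b' h => simp only [rev, gWeight, inv_inv, key _ _ _ _ _ _ (hne h).symm]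
  | rowDown b b' h => simp only [rev, gWeight, inv_inv, key _ _ _ _ _ _ (hne h).symm]
  | firstToTopRight =>
    simp only [rev, gWeight, inv_inv, inv_pow, key0 i]
    rw [← key j 0 (Fin.rev 0) q q⁻¹ 1 h0]
    simp
  | firstToBottomLeft =>
    simp only [rev, gWeight, inv_inv, inv_pow, key0 j]
    rw [← key i 0 (Fin.rev 0) q q⁻¹ 1 h0]
    simp
  | lastToTopRight =>
    simp only [rev, gWeight, inv_inv, inv_pow, key1 j]
    rw [← key i 0 (Fin.rev 0) q q⁻¹ 1 h0]
    simp
  | lastToBottomLeft =>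
    simp only [rev, gWeight, inv_inv, inv_pow, key1 i]
    rw [← key j 0 (Fin.rev 0) q q⁻¹ 1 h0]
    simp

theorem src_rev (f : Family N) (p : Fin N × Fin N) : f.rev.Src p ↔ f.Src (revPair p) := by
  cases f <;> simp [rev, Src, revPair, Fin.rev_eq_iff]

theorem arrow_rev (f : Family N) (p : Fin N × Fin N) :
    f.rev.arrow p = revPair (f.arrow (revPair p)) := by
  cases f <;> simp [rev, arrow, revPair]

theorem exists_src (f : Family N) : ∃ p, f.Src p := by
  cases f with
  | colLeft b b' h | colRight b b' h => exact ⟨(0, b), rfl⟩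
  | rowUp b b' h | rowDown b b' h => exact ⟨(b, 0), rfl⟩
  | firstToTopRight | firstToBottomLeft => exact ⟨(0, 0), rfl, rfl⟩
  | lastToTopRight | lastToBottomLeft => exact ⟨(Fin.rev 0, Fin.rev 0), rfl, rfl⟩

/-- Arrows of a family are not composable, so x² kills the generators. -/
theorem arrow_not_src (hN : 1 < N) (f : Family N) (p : Fin N × Fin N) : ¬ f.Src (f.arrow p) := by
  have h0 := zero_ne_rev_zero hN
  cases f with
  | colLeft b b' h | colRight b b' h | rowUp b b' h | rowDown b b' h =>
    intro h'
    have : b' = b := h'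
    subst this
    omega
  | _ => simp [Src, arrow, h0, h0.symm]

/-- This is the relation g x = lam x g, read off on the generators. -/
theorem gWeight_arrow {q : k} (hq : q ≠ 0) (hN : 1 < N) (f : Family N) (p : Fin N × Fin N)
    (hp : f.Src p) :
    f.gWeight q (f.arrow p).1 (f.arrow p).2 = f.lamValue q * f.gWeight q p.1 p.2 := by
  have h0 := zero_ne_rev_zero hN
  cases f with
  | colLeft b b' h | colRight b b' h | rowUp b b' h | rowDown b b' h =>
    have hne : b ≠ b' := by rintro rfl; omega
    simp only [Src] at hp
    simp [gWeight, arrow, lamValue, hp, hne, hne.symm]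
    try field_simp
  | _ =>
    simp only [Src] at hp
    simp [gWeight, arrow, lamValue, hp.1, hp.2, h0.symm]
    try field_simp

theorem exists_gWeight_eq_mul {q : k} (hq : q ≠ 0) (f : Family N) :
    ∃ a b : Fin N → kˣ, ∀ i j, f.gWeight q i j = a i * b j := by
  have key : ∃ a b : Fin N → k, (∀ i, a i ≠ 0) ∧ (∀ j, b j ≠ 0) ∧
      ∀ i j, f.gWeight q i j = a i * b j := by
    have h2 : ∀ (P : Prop) [Decidable P] (x : k), x ≠ 0 → (if P then x else 1) ≠ 0 := by
      intro P _ x hx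
      split_ifs <;> simp [hx]
    have h3 : ∀ (P Q : Prop) [Decidable P] [Decidable Q] (x y : k), x ≠ 0 → y ≠ 0 →
        (if P then x else if Q then y else 1) ≠ 0 := by
      intro P Q _ _ x y hx hy
      split_ifs <;> simp [hx, hy]
    have hi := inv_ne_zero hq
    have hs := pow_ne_zero 2 hq
    cases f with
    | colLeft b b' h | colRight b b' h =>
      exact ⟨fun _ => 1, _, fun _ => one_ne_zero, fun j => h3 (j = _) (j = _) _ _ (by assumption)
        (by assumption), fun i j => (one_mul _).symm⟩
    | rowUp b b' h | rowDown b b' h =>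
      exact ⟨_, fun _ => 1, fun i => h3 (i = _) (i = _) _ _ (by assumption) (by assumption),
        fun _ => one_ne_zero, fun i j => (mul_one _).symm⟩
    | firstToTopRight =>
      exact ⟨_, _, fun i => h2 (i = 0) _ (inv_ne_zero hs),
        fun j => h3 (j = 0) (j = Fin.rev 0) _ _ hi hq, fun i j => rfl⟩
    | lastToBottomLeft =>
      exact ⟨_, _, fun i => h2 (i = Fin.rev 0) _ hs,
        fun j => h3 (j = 0) (j = Fin.rev 0) _ _ hi hq, fun i j => rfl⟩
    | firstToBottomLeft =>
      exact ⟨_, _, fun i => h3 (i = 0) (i = Fin.rev 0) _ _ hi hq,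
        fun j => h2 (j = 0) _ (inv_ne_zero hs), fun i j => mul_comm _ _⟩
    | lastToTopRight =>
      exact ⟨_, _, fun i => h3 (i = 0) (i = Fin.rev 0) _ _ hi hq,
        fun j => h2 (j = Fin.rev 0) _ hs, fun i j => mul_comm _ _⟩
  obtain ⟨a, b, ha, hb, h⟩ := key
  exact ⟨fun i => Units.mk0 (a i) (ha i), fun j => Units.mk0 (b j) (hb j), h⟩

theorem gWeight_pow {q : k} {n : ℕ} (hq : q ^ n = 1) (f : Family N) (i j : Fin N) :
    f.gWeight q i j ^ n = 1 := by
  have h2 : (q ^ 2) ^ n = 1 := by rw [← pow_mul, mul_comm, pow_mul, hq, one_pow]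
  cases f <;> simp only [gWeight, mul_pow] <;> split_ifs <;> simp [hq, h2]

/-- Exhibits q as an eigenvalue of g. In the corner families the index 1 avoids the row or column
that carries the factor q² or q⁻². -/
theorem exists_gWeight_eq (hN : 3 ≤ N) (q : k) (f : Family N) : ∃ i j, f.gWeight q i j = q := by
  have h0 : (Fin.rev 0 : Fin N) ≠ 0 := (zero_ne_rev_zero (by omega)).symm
  have h1 : (⟨1, by omega⟩ : Fin N) ≠ 0 := by
    intro h; simpa using congrArg Fin.val h
  have h2 : (⟨1, by omega⟩ : Fin N) ≠ Fin.rev 0 := by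
    intro h
    have := congrArg Fin.val h
    rw [Fin.val_rev, Fin.val_zero] at this
    simp at this
    omega
  cases f with
  | colLeft b b' h => exact ⟨0, b', by simp [gWeight]⟩
  | colRight b b' h => exact ⟨0, b, by simp [gWeight]⟩
  | rowUp b b' h => exact ⟨b', 0, by simp [gWeight]⟩
  | rowDown b b' h => exact ⟨b, 0, by simp [gWeight]⟩
  | firstToTopRight => exact ⟨⟨1, by omega⟩, Fin.rev 0, by simp [gWeight, h0, h1]⟩
  | firstToBottomLeft => exact ⟨Fin.rev 0, ⟨1, by omega⟩, by simp [gWeight, h0, h1]⟩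
  | lastToTopRight => exact ⟨Fin.rev 0, ⟨1, by omega⟩, by simp [gWeight, h0, h2]⟩
  | lastToBottomLeft => exact ⟨⟨1, by omega⟩, Fin.rev 0, by simp [gWeight, h0, h2]⟩

/-! ### Each family defines a skew derivation -/

section Compatibility

variable {M : Type*} [AddCommGroup M] [Module k M]

theorem compatible_iff {q d : k} (f : Family N) {α : Fin N × Fin N → k} :
    Compatible M q id α (f.coeff d) ↔ ∀ β : Fin N × Fin N → Fin N × Fin N → M, IsQuadratic q β →
      IsQuadratic q fun p t => (if f.Src p then d else 0) • β (f.arrow p) t +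
        (α p * if f.Src t then d else 0) • β p (f.arrow t) := by
  have : ∀ β : Fin N × Fin N → Fin N × Fin N → M, twist id α (f.coeff d) β = fun p t =>
      (if f.Src p then d else 0) • β (f.arrow p) t +
        (α p * if f.Src t then d else 0) • β p (f.arrow t) := by
    intro β
    funext p t
    exact twist_monomial id α (fun p => if f.Src p then d else 0) f.arrow β p t
  simp only [Compatible, this]

/-- Any third column lies on the same side of the adjacent columns b and b', so relations with it
keep their form when b is replaced by b'. Only the relations within these two columns involve the
weights q and q⁻¹. -/
theorem compatible_colRight {q : k} (hq : q ≠ 0) (d : k) {b b' : Fin N} (h : (b : ℕ) + 1 = b') :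
    Compatible M q id (fun p => (colRight b b' h).gWeight q p.1 p.2) ((colRight b b' h).coeff d) := by
  rw [compatible_iff]
  intro β hβ
  have hbb : b < b' := by change (b : ℕ) < b'; omega
  have hgap : ∀ {x : Fin N}, b < x → x ≠ b' → b' < x := fun {x} h1 h2 => by
    have h1' : (b : ℕ) < x := h1
    have h2' : (x : ℕ) ≠ b' := fun h => h2 (Fin.ext h)
    change (b' : ℕ) < x
    omega
  constructor
  · intro i l j hil
    by_cases hj : j = b
    · subst hj
      simp only [Src, arrow, gWeight, if_true]
      rw [hβ.diag i j l b' hil hbb, ← hβ.anti i b' l j hil hbb]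
      match_scalars <;> first | ring1 | (field_simp; ring1)
    · simp [Src, hj]
  · intro i j r hjr
    by_cases hj : j = b
    · subst hj
      by_cases hr : r = b'
      · subst hr
        simp [Src, arrow, gWeight, hjr.ne', smul_smul, hq]
      · simp only [Src, arrow, gWeight, hr, hjr.ne', if_true, if_false]
        rw [hβ.row i b' r (hgap hjr hr)]
        module
    · by_cases hr : r = b
      · subst hr
        simp only [Src, arrow, gWeight, hj, (hjr.trans hbb).ne, if_true, if_false]
        rw [hβ.row i j b' (hjr.trans hbb)]
        module
      · simp [Src, hj, hr]
  · intro i j l r hil hrj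
    by_cases hj : j = b
    · subst hj
      simp only [Src, arrow, gWeight, hrj.ne, (hrj.trans hbb).ne, if_true, if_false]
      rw [hβ.anti i b' l r hil (hrj.trans hbb)]
      module
    · by_cases hr : r = b
      · subst hr
        by_cases hj' : j = b'
        · subst hj'
          simp only [Src, arrow, gWeight, hj, if_true, if_false]
          rw [hβ.col i l j hil]
          match_scalars <;> first | ring1 | field_simp
        · simp only [Src, arrow, gWeight, hj, hj', if_true, if_false]
          rw [hβ.anti i j l b' hil (hgap hrj hj')]
          module
      · simp [Src, hj, hr]
  · intro i j l r hil hjr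
    by_cases hj : j = b
    · subst hj
      by_cases hr : r = b'
      · subst hr
        simp only [Src, arrow, gWeight, hjr.ne', if_true, if_false]
        rw [hβ.col i l r hil]
        match_scalars <;> first | ring1 | (field_simp; ring1)
      · simp only [Src, arrow, gWeight, hr, hjr.ne', if_true, if_false]
        rw [hβ.diag i b' l r hil (hgap hjr hr)]
        module
    · by_cases hr : r = b
      · subst hr
        simp only [Src, arrow, gWeight, hj, (hjr.trans hbb).ne, if_true, if_false]
        rw [hβ.diag i j l b' hil (hjr.trans hbb)]
        module
      · simp [Src, hj, hr]

theorem compatible_firstToTopRight {q : k} (hq : q ≠ 0) (hN : 1 < N) (d : k) :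
    Compatible M q id (fun p => (firstToTopRight : Family N).gWeight q p.1 p.2)
      ((firstToTopRight : Family N).coeff d) := by
  rw [compatible_iff]
  intro β hβ
  have h0 := zero_ne_rev_zero hN
  have hpos : (0 : Fin N) < Fin.rev 0 := Fin.pos_iff_ne_zero.mpr h0.symm
  have hlt : ∀ {r : Fin N}, r ≠ Fin.rev 0 → r < Fin.rev 0 := fun {r} hr =>
    lt_of_le_of_ne (Fin.le_rev_iff.mpr (Fin.zero_le _)) hr
  have hne : ∀ {i l : Fin N}, i < l → l ≠ 0 := fun {i l} h =>
    ((Fin.zero_le i).trans_lt h).ne'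
  constructor
  · intro i l j hil
    by_cases hp : i = 0 ∧ j = 0
    · obtain ⟨rfl, rfl⟩ := hp
      simp only [Src, arrow, gWeight, hne hil, if_true, if_false, false_and, and_self]
      rw [hβ.anti 0 (Fin.rev 0) l 0 hil hpos]
      match_scalars <;> first | ring1 | field_simp
    · simp [Src, hp, hne hil]
  · intro i j r hjr
    by_cases hp : i = 0 ∧ j = 0
    · obtain ⟨rfl, rfl⟩ := hp
      by_cases hr : r = Fin.rev 0
      · subst hr
        simp only [Src, arrow, gWeight, hne hjr, if_true, if_false, and_false, and_self]
        match_scalars <;> first | ring1 | field_simp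
      · simp only [Src, arrow, gWeight, hne hjr, hr, if_true, if_false, and_false, and_self]
        rw [hβ.row 0 r (Fin.rev 0) (hlt hr)]
        match_scalars <;> first | ring1 | field_simp
    · simp [Src, hp, hne hjr]
  · intro i j l r hil hrj
    simp [Src, hne hil, hne hrj]
  · intro i j l r hil hjr
    by_cases hp : i = 0 ∧ j = 0
    · obtain ⟨rfl, rfl⟩ := hp
      by_cases hr : r = Fin.rev 0
      · subst hr
        simp only [Src, arrow, gWeight, hne hil, hne hjr, if_true, if_false, and_false, false_and,
          and_self]
        rw [hβ.col 0 l (Fin.rev 0) hil]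
        match_scalars <;> ring1
      · simp only [Src, arrow, gWeight, hne hil, hne hjr, hr, if_true, if_false, and_false,
          false_and, and_self]
        rw [hβ.anti 0 (Fin.rev 0) l r hil (hlt hr)]
        module
    · simp [Src, hp, hne hil, hne hjr]

theorem compatible_transpose {q d : k} {f : Family N}
    (h : Compatible M q id (fun p => f.gWeight q p.1 p.2) (f.coeff d)) :
    Compatible M q id (fun p => f.transpose.gWeight q p.1 p.2) (f.transpose.coeff d) := by
  have h' : Compatible M q id _ _ := h.swap
  convert h' using 2 with p p
  · exact gWeight_transpose q f p.1 p.2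
  · funext s
    simp only [coeff, src_transpose, arrow_transpose]
    congr 1
    rw [eq_iff_iff]
    exact ⟨fun h => by rw [h, Prod.swap_swap], fun h => by rw [← h, Prod.swap_swap]⟩

theorem compatible_rev {q d : k} (hq : q ≠ 0) (hN : 1 < N) {f : Family N}
    (h : Compatible M q id (fun p => f.gWeight q p.1 p.2) (f.coeff d)) :
    Compatible M q⁻¹ id (fun p => f.rev.gWeight q⁻¹ p.1 p.2) (f.rev.coeff d) := by
  convert h.rev hq using 2 with p p
  · exact gWeight_rev hN q f p.1 p.2
  · funext s
    simp only [coeff, src_rev, arrow_rev]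
    congr 1
    rw [eq_iff_iff]
    exact ⟨fun h => by rw [h, revPair_revPair], fun h => by rw [← h, revPair_revPair]⟩

/-- Transposition and reversal generate all families from `colRight` and `firstToTopRight`; these
two are therefore used at every nonzero q, including q⁻¹. -/
theorem compatible {q : k} (hq : q ≠ 0) (hN : 1 < N) (d : k) (f : Family N) :
    Compatible M q id (fun p => f.gWeight q p.1 p.2) (f.coeff d) := by
  have hrev : ∀ f : Family N, (∀ q : k, q ≠ 0 →
      Compatible M q id (fun p => f.rev.gWeight q p.1 p.2) (f.rev.coeff d)) →
      Compatible M q id (fun p => f.gWeight q p.1 p.2) (f.coeff d) := fun f h => by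
    have := compatible_rev (inv_ne_zero hq) hN (h _ (inv_ne_zero hq))
    rwa [inv_inv, rev_rev] at this
  have hright : ∀ (b b' : Fin N) h (q : k), q ≠ 0 → Compatible M q id
      (fun p => (colRight b b' h).gWeight q p.1 p.2) ((colRight b b' h).coeff d) :=
    fun b b' h q hq => compatible_colRight hq d h
  have hfirst : ∀ q : k, q ≠ 0 → Compatible M q id
      (fun p => (firstToTopRight : Family N).gWeight q p.1 p.2)
      ((firstToTopRight : Family N).coeff d) :=
    fun q hq => compatible_firstToTopRight hq hN d
  cases f with
  | colRight b b' h => exact hright _ _ h q hq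
  | rowDown b b' h => exact compatible_transpose (hright _ _ h q hq)
  | colLeft b b' h => exact hrev _ fun q hq => hright _ _ _ q hq
  | rowUp b b' h => exact hrev _ fun q hq => compatible_transpose (hright _ _ _ q hq)
  | firstToTopRight => exact hfirst q hq
  | firstToBottomLeft => exact compatible_transpose (hfirst q hq)
  | lastToBottomLeft => exact hrev _ hfirst
  | lastToTopRight => exact hrev _ fun q hq => compatible_transpose (hfirst q hq)

end Compatibility

end Family

/-! ### Classification of skew derivations for diagonal automorphisms -/

section Diagonal

variable {k : Type u} [Field k] {q lam : k} {N : ℕ} [NeZero N]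

/-- The weights `α` are those of a family, the matrix `C` is constant on the arrows of this
family, and `p₀ → s₀` is one of these arrows. -/
def FitsFamily (q lam : k) (α : Fin N × Fin N → k) (C : Fin N × Fin N → Fin N × Fin N → k)
    (p₀ s₀ : Fin N × Fin N) : Prop :=
  ∃ f : Family N, lam = f.lamValue q ∧ (∀ p, α p = f.gWeight q p.1 p.2) ∧ f.Src p₀ ∧
    f.arrow p₀ = s₀ ∧ ∀ p, f.Src p → C p (f.arrow p) = C p₀ s₀

variable {α : Fin N × Fin N → k} {C : Fin N × Fin N → Fin N × Fin N → k}

theorem FitsFamily.of_swap {p s : Fin N × Fin N}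
    (h : FitsFamily q lam (fun p => α p.swap) (fun p s => C p.swap s.swap) p.swap s.swap) :
    FitsFamily q lam α C p s := by
  obtain ⟨f, h1, h2, h3, h4, h5⟩ := h
  refine ⟨f.transpose, h1.trans (f.lamValue_transpose q).symm, fun p => ?_,
    (f.src_transpose p).mpr h3, ?_, fun p' hp' => ?_⟩
  · rw [f.gWeight_transpose]; exact h2 p.swap
  · rw [f.arrow_transpose, h4, Prod.swap_swap]
  · rw [f.arrow_transpose]
    simpa using h5 p'.swap ((f.src_transpose p').mp hp')

theorem FitsFamily.of_rev (hN : 1 < N) {p s : Fin N × Fin N}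
    (h : FitsFamily q⁻¹ lam (fun p => α (revPair p)) (fun p s => C (revPair p) (revPair s))
      (revPair p) (revPair s)) :
    FitsFamily q lam α C p s := by
  obtain ⟨f, h1, h2, h3, h4, h5⟩ := h
  have hl := f.lamValue_rev q⁻¹
  rw [inv_inv] at hl
  refine ⟨f.rev, h1.trans hl.symm, fun p => ?_, (f.src_rev p).mpr h3, ?_, fun p' hp' => ?_⟩
  · have hg := f.gWeight_rev hN q⁻¹ p.1 p.2
    rw [inv_inv] at hg
    have h' := h2 (revPair p)
    simp only [revPair_revPair] at h'
    rw [hg, h']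
    rfl
  · rw [f.arrow_rev, h4, revPair_revPair]
  · rw [f.arrow_rev]
    simpa using h5 (revPair p') ((f.src_rev p').mp hp')

theorem fitsFamily_of_lt (hN : 1 < N) (hq0 : q ≠ 0) (hq2 : q ^ 2 ≠ 1) (hlam : lam ^ 2 ≠ 1)
    {a b : Fin N → k} (hα : ∀ p, α p = a p.1 * b p.2) (hα0 : ∀ p, α p ≠ 0)
    (hC : ∀ p s, C p s ≠ 0 → α s = lam * α p) (H : Compatible k q id α C) {i j r : Fin N}
    (hjr : j < r) (h : C (i, j) (i, r) ≠ 0) : FitsFamily q lam α C (i, j) (i, r) := by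
  have H' := H.component (i, j) (i, r)
  have hshape : (fun p s => if weight s + weight (i, j) = weight p + weight (i, r)
      then C p s else 0) =
      fun p s => if s = (p.1, r) then (if p.2 = j then C (p.1, j) (p.1, r) else 0) else 0 := by
    funext p s
    simp only [weight_shift_row hjr.ne]
    split_ifs with h1 h2 h3 h4 h5
    · rw [← h1.1, h1.2]
    all_goals tauto
  rw [hshape] at H'
  -- One nonzero entry suffices: α is a product of a row factor and a column factor, so the ratio of
  -- two columns is the same in all rows.
  have hb : ∀ l, α (l, r) = lam * α (l, j) := by
    intro l
    have h1 := hC _ _ h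
    have h2 := hα0 (i, j)
    simp only [hα] at h1 h2 ⊢
    have h3 := left_ne_zero_of_mul h2
    have h4 : b r = lam * b j := mul_left_cancel₀ h3 (by linear_combination h1)
    rw [h4]; ring
  rcases classify_row_right hN hq0 hq2 hlam hα0 hjr hb
      (c := fun l => C (l, j) (l, r)) H' (i₀ := i) h with
    ⟨h1, h2, h3, h4⟩ | ⟨h1, rfl, rfl, h4, h5⟩
  · refine ⟨Family.colRight j r h1, h2, fun p => h3 p.1 p.2, rfl, rfl, ?_⟩
    rintro ⟨l, j'⟩ hp
    obtain rfl : j' = j := hp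
    exact h4 l
  · have hi : i = 0 := by
      by_contra hi
      exact h (h5 i hi)
    subst hi
    refine ⟨Family.firstToTopRight, h1, fun p => h4 p.1 p.2, ⟨rfl, rfl⟩, rfl, ?_⟩
    rintro ⟨l, j'⟩ ⟨hl, hj⟩
    obtain rfl : l = 0 := hl
    obtain rfl : j' = 0 := hj
    rfl

theorem fitsFamily_of_row (hN : 1 < N) (hq0 : q ≠ 0) (hq2 : q ^ 2 ≠ 1) (hlam : lam ^ 2 ≠ 1)
    {a b : Fin N → k} (hα : ∀ p, α p = a p.1 * b p.2) (hα0 : ∀ p, α p ≠ 0)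
    (hC : ∀ p s, C p s ≠ 0 → α s = lam * α p) (H : Compatible k q id α C) {i j r : Fin N}
    (h : C (i, j) (i, r) ≠ 0) : FitsFamily q lam α C (i, j) (i, r) := by
  rcases lt_trichotomy j r with hjr | rfl | hjr
  · exact fitsFamily_of_lt hN hq0 hq2 hlam hα hα0 hC H hjr h
  -- A diagonal entry of C would force lam = 1.
  · have h1 := hC _ _ h
    have : lam = 1 := mul_right_cancel₀ (hα0 (i, j)) (by linear_combination -h1)
    exact absurd (by rw [this, one_pow]) hlam
  · refine FitsFamily.of_rev hN ?_
    refine fitsFamily_of_lt hN (inv_ne_zero hq0) ?_ hlam (a := fun i => a i.rev)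
      (b := fun j => b j.rev) (fun p => hα (revPair p)) (fun p => hα0 _) (fun p s => hC _ _)
      (H.rev hq0) (Fin.rev_lt_rev.mpr hjr) ?_
    · rwa [inv_pow, ne_eq, inv_eq_one]
    · simpa using h

theorem fitsFamily_of_ne_zero (hN : 3 ≤ N) (hq0 : q ≠ 0) (hq2 : q ^ 2 ≠ 1) (hlam : lam ^ 2 ≠ 1)
    {a b : Fin N → k} (hα : ∀ p, α p = a p.1 * b p.2) (hα0 : ∀ p, α p ≠ 0)
    (hC : ∀ p s, C p s ≠ 0 → α s = lam * α p) (H : Compatible k q id α C) {p s : Fin N × Fin N}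
    (h : C p s ≠ 0) : FitsFamily q lam α C p s := by
  obtain ⟨i, j⟩ := p
  obtain ⟨l, r⟩ := s
  by_cases hil : i = l
  · subst hil
    exact fitsFamily_of_row (by omega) hq0 hq2 hlam hα hα0 hC H h
  by_cases hjr : j = r
  · subst hjr
    refine FitsFamily.of_swap ?_
    exact fitsFamily_of_row (by omega) hq0 hq2 hlam (a := b) (b := a)
      (fun p => (hα p.swap).trans (mul_comm _ _)) (fun p => hα0 _) (fun p s => hC _ _) H.swap h
  -- The arrow changes both indices, so it is a weight component by itself. Its source must be a
  -- corner on the main diagonal, and reversal reduces the last corner to the first.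
  exfalso
  have single : ∀ {q : k} {α : Fin N × Fin N → k} {C : Fin N × Fin N → Fin N × Fin N → k}
      {i j l r : Fin N}, Compatible k q id α C → i ≠ l → j ≠ r → Compatible k q id α
      fun p s => if s = (l, r) then (if p = (i, j) then C (i, j) (l, r) else 0) else 0 := by
    intro q α C i j l r H hil hjr
    convert H.component (i, j) (l, r) using 3 with p s
    simp only [weight_shift_of_ne hil hjr]
    split_ifs with h1 h2 h3 h4 h5
    · rw [h1, h2]
    all_goals tauto
  have hcorner := fun a b => corner_of_compatible_single hq0 hq2 hα0 h (single H hil hjr)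
    (a := a) (b := b)
  by_cases hi : (i : ℕ) = 0
  · have hj : (j : ℕ) = 0 := by
      by_contra hj
      have h1 : i < (⟨1, by omega⟩ : Fin N) := by change (i : ℕ) < 1; omega
      have h2 : (⟨0, by omega⟩ : Fin N) < j := by change 0 < (j : ℕ); omega
      exact (hcorner _ _).1 ⟨h1, h2⟩
    exact not_compatible_single_first hN hq0 hq2 hα0 h hi hj hil hjr (single H hil hjr)
  · have hj : (j : ℕ) + 1 = N := by
      by_contra hj
      have h1 : (⟨0, by omega⟩ : Fin N) < i := by change 0 < (i : ℕ); omega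
      have h2 : j < (⟨N - 1, by omega⟩ : Fin N) := by change (j : ℕ) < N - 1; omega
      exact (hcorner _ _).2 ⟨h1, h2⟩
    have hi : (i : ℕ) + 1 = N := by
      by_contra hi
      have h1 : i < (⟨N - 1, by omega⟩ : Fin N) := by change (i : ℕ) < N - 1; omega
      have h2 : (⟨0, by omega⟩ : Fin N) < j := by change 0 < (j : ℕ); omega
      exact (hcorner _ _).1 ⟨h1, h2⟩
    have hil' : i.rev ≠ l.rev := fun h => hil (Fin.rev_injective h)
    have hjr' : j.rev ≠ r.rev := fun h => hjr (Fin.rev_injective h)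
    have hq2' : q⁻¹ ^ 2 ≠ 1 := by rwa [inv_pow, ne_eq, inv_eq_one]
    refine not_compatible_single_first hN (inv_ne_zero hq0) hq2' (fun p => hα0 (revPair p)) ?_
      (i := i.rev) (j := j.rev) ?_ ?_ hil' hjr' (single (H.rev hq0) hil' hjr')
    · simpa using h
    · rw [Fin.val_rev]; omega
    · rw [Fin.val_rev]; omega

end Diagonal

/-! ### The case of automorphisms involving the transposition -/

section Transposed

variable {k : Type u} [Field k] {q lam : k} {N : ℕ} {α : Fin N × Fin N → k}
  {C : Fin N × Fin N → Fin N × Fin N → k}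

theorem single_add_single_mem {a x v h : Fin N}
    (e : (Pi.single a 1 + Pi.single x 1 : Fin N → ℤ) = Pi.single v 1 + Pi.single h 1) :
    a = v ∨ a = h := by
  have := congrFun e a
  simp only [Pi.add_apply, Pi.single_apply] at this
  by_contra! hne
  simp [hne.1, hne.2] at this
  split_ifs at this <;> omega

theorem exists_ne_ne (hN : 3 ≤ N) (i j : Fin N) : ∃ h : Fin N, h ≠ i ∧ h ≠ j := by
  by_contra! H
  have h1 : (Finset.univ : Finset (Fin N)) ⊆ {i, j} := by
    intro x _
    by_cases hx : x = i
    · simp [hx]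
    · simp [H x hx]
  have h2 := Finset.card_le_card h1
  have h3 : ({i, j} : Finset (Fin N)).card ≤ 2 := Finset.card_le_two
  rw [Finset.card_univ, Fintype.card_fin] at h2
  omega

/-- Choose x outside {i, j} and compare Y_ij Y_ix with Y_ix Y_ij, using a form concentrated on the
weight of Y_uv Y_ix. The hypotheses on (u, v) exclude by weight every term except C (i, j) (u, v).
-/
theorem transposed_coeff_eq_zero (hN : 3 ≤ N) (hq : q ≠ 0)
    (H : Compatible k q Prod.swap α C) {i j u v : Fin N}
    (h : (v ≠ i ∧ v ≠ j) ∨ (i ≠ j ∧ u = i ∧ v = i)) : C (i, j) (u, v) = 0 := by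
  obtain ⟨x, hxi, hxj⟩ := exists_ne_ne hN i j
  obtain ⟨β₀, hβ₀, hne⟩ := exists_isQuadratic_ne_zero hq (u, v) (i, x)
  set w := weight (u, v) + weight (i, x) with hw
  set β : Fin N × Fin N → Fin N × Fin N → k :=
    fun p t => if weight p + weight t = w then β₀ p t else 0 with hβdef
  have hβ : IsQuadratic q β := hβ₀.component w
  have hT := H β hβ
  have hL : twist Prod.swap α C β (i, j) (i, x) = C (i, j) (u, v) * β₀ (u, v) (i, x) := by
    rw [twist, Finset.sum_eq_single (u, v), Finset.sum_eq_zero]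
    · simp [hβdef, hw]
    · rintro ⟨s₁, s₂⟩ -
      have : weight (j, i) + weight (s₁, s₂) ≠ w := by
        intro e
        simp only [weight, hw, Prod.mk_add_mk, Prod.mk.injEq] at e
        rcases h with h | h
        · rcases single_add_single_mem e.2 with h' | h'
          exacts [h.1 h'.symm, hxi h'.symm]
        · rcases single_add_single_mem e.1 with h' | h'
          exacts [h.1 (h'.trans h.2.1).symm, h.1 h'.symm]
      simp [hβdef, this]
    · rintro s - hs
      have : weight s + weight (i, x) ≠ w := by
        intro e
        rw [hw, add_left_inj] at e
        refine hs (Prod.ext ?_ ?_)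
        · by_contra hne
          simpa [weight, Pi.single_apply, hne] using congrFun (congrArg Prod.fst e) s.1
        · by_contra hne
          simpa [weight, Pi.single_apply, hne] using congrFun (congrArg Prod.snd e) s.2
      simp [hβdef, this]
    · simp
  have hR : twist Prod.swap α C β (i, x) (i, j) = 0 := by
    rw [twist, Finset.sum_eq_zero, Finset.sum_eq_zero, smul_zero, zero_add]
    · rintro ⟨s₁, s₂⟩ -
      have : weight (x, i) + weight (s₁, s₂) ≠ w := by
        intro e
        simp only [weight, hw, Prod.mk_add_mk, Prod.mk.injEq] at e
        rcases h with h | h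
        · rcases single_add_single_mem e.2 with h' | h'
          exacts [h.1 h'.symm, hxi h'.symm]
        · rcases single_add_single_mem e.1 with h' | h'
          exacts [hxi (h'.trans h.2.1), hxi h']
      simp [hβdef, this]
    · rintro ⟨s₁, s₂⟩ -
      have : weight (s₁, s₂) + weight (i, j) ≠ w := by
        intro e
        rw [add_comm] at e
        simp only [weight, hw, Prod.mk_add_mk, Prod.mk.injEq] at e
        rcases single_add_single_mem e.2 with h' | h'
        · rcases h with h | h
          exacts [h.2 h'.symm, h.1 (h'.trans h.2.2).symm]
        · exact hxj h'.symm
      simp [hβdef, this]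
  have hL0 : twist Prod.swap α C β (i, j) (i, x) = 0 := by
    rcases lt_or_gt_of_ne hxj with hlt | hlt
    · have := hT.row i x j hlt
      rw [hR, smul_eq_mul] at this
      exact (mul_eq_zero.mp this.symm).resolve_left hq
    · rw [hT.row i j x hlt, hR, smul_zero]
  rw [hL] at hL0
  exact (mul_eq_zero.mp hL0).resolve_right hne

/-- The vanishing lemma and its transpose leave only s = p and s = swap p. Applying g x = lam x g
twice to such an entry returns it multiplied by lam², since α_s α_{swap s} = α_p α_{swap p}. -/
theorem transposed_eq_zero (hN : 3 ≤ N) (hq : q ≠ 0) (hlam : lam ^ 2 ≠ 1)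
    (hα0 : ∀ p, α p ≠ 0) (hC : ∀ p s, C p s * α s = lam * α p * C p.swap s.swap)
    (H : Compatible k q Prod.swap α C) (p s : Fin N × Fin N) : C p s = 0 := by
  obtain ⟨i, j⟩ := p
  obtain ⟨u, v⟩ := s
  by_contra hne
  have h1 := mt (transposed_coeff_eq_zero hN hq H) hne
  have h2 := mt (transposed_coeff_eq_zero hN hq (i := j) (j := i) (u := v) (v := u) H.swap) hne
  have h3 : (u = i ∧ v = j) ∨ (u = j ∧ v = i) := by
    by_cases hij : i = j
    · subst hij; tauto
    · have hji : j ≠ i := Ne.symm hij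
      tauto
  have h4 := hC (i, j) (u, v)
  have h5 := hC (j, i) (v, u)
  simp only [Prod.swap_prod_mk] at h4 h5
  have h6 : α (u, v) * α (v, u) = α (i, j) * α (j, i) := by
    rcases h3 with ⟨rfl, rfl⟩ | ⟨rfl, rfl⟩
    · rfl
    · exact mul_comm _ _
  refine hlam (mul_left_cancel₀ hne (mul_right_cancel₀
    (mul_ne_zero (hα0 (i, j)) (hα0 (j, i))) ?_))
  linear_combination C (i, j) (u, v) * h6 - α (v, u) * h4 - lam * α (i, j) * h5

end Transposed

/-! ### The group generated by the torus and the transposition -/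

/-- Transposition interchanges the two factors of the torus, so the diagonal maps and their
composites with it are closed under products and inverses. -/
theorem exists_of_mem_torusTranspose {k : Type u} [Field k] {q : k} {N : ℕ}
    {φ : QMat k q N ≃ₐ[k] QMat k q N} (hφ : φ ∈ QMat.torusTranspose k q N) :
    ∃ a b : Fin N → kˣ,
      (∀ p, φ (QMat.gen k q N p) = ((a p.1 : k) * b p.2) • QMat.gen k q N p) ∨
      ∀ p, φ (QMat.gen k q N p) = ((a p.1 : k) * b p.2) • QMat.gen k q N p.swap := by
  let S : Subgroup (QMat k q N ≃ₐ[k] QMat k q N) :=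
    { carrier := {φ | ∃ a b : Fin N → kˣ,
        (∀ p, φ (QMat.gen k q N p) = ((a p.1 : k) * b p.2) • QMat.gen k q N p) ∨
        ∀ p, φ (QMat.gen k q N p) = ((a p.1 : k) * b p.2) • QMat.gen k q N p.swap}
      one_mem' := ⟨1, 1, Or.inl fun p => by simp⟩
      mul_mem' := by
        rintro φ ψ ⟨a, b, h⟩ ⟨a', b', h'⟩
        rcases h with h | h <;> rcases h' with h' | h'
        · refine ⟨a * a', b * b', Or.inl fun p => ?_⟩
          rw [AlgEquiv.mul_apply, h', map_smul, h, smul_smul]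
          congr 1
          simp only [Pi.mul_apply, Units.val_mul]
          ring
        · refine ⟨a' * b, b' * a, Or.inr fun p => ?_⟩
          rw [AlgEquiv.mul_apply, h', map_smul, h, smul_smul]
          congr 1
          simp only [Pi.mul_apply, Units.val_mul, Prod.fst_swap, Prod.snd_swap]
          ring
        · refine ⟨a * a', b * b', Or.inr fun p => ?_⟩
          rw [AlgEquiv.mul_apply, h', map_smul, h, smul_smul]
          congr 1
          simp only [Pi.mul_apply, Units.val_mul]
          ring
        · refine ⟨a' * b, b' * a, Or.inl fun p => ?_⟩
          rw [AlgEquiv.mul_apply, h', map_smul, h, smul_smul, Prod.swap_swap]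
          congr 1
          simp only [Pi.mul_apply, Units.val_mul, Prod.fst_swap, Prod.snd_swap]
          ring
      inv_mem' := by
        rintro φ ⟨a, b, h | h⟩
        · refine ⟨a⁻¹, b⁻¹, Or.inl fun p => φ.injective ?_⟩
          rw [map_smul, h, smul_smul, ← AlgEquiv.mul_apply, mul_inv_cancel, AlgEquiv.one_apply]
          simp [mul_mul_mul_comm]
        · refine ⟨b⁻¹, a⁻¹, Or.inr fun p => φ.injective ?_⟩
          rw [map_smul, h, smul_smul, ← AlgEquiv.mul_apply, mul_inv_cancel, AlgEquiv.one_apply,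
            Prod.swap_swap]
          convert (one_smul k _).symm using 2
          simp
          field_simp }
  have hS : QMat.torusTranspose k q N ≤ S := by
    refine sup_le ?_ ((Subgroup.zpowers_le).mpr ?_)
    · rintro _ ⟨⟨a, b⟩, rfl⟩
      exact ⟨a, b, Or.inl fun p => QMat.scaleHom_Y q a b p.1 p.2⟩
    · exact ⟨1, 1, Or.inr fun p =>
        (QMat.transposeHom_Y k q N p.1 p.2).trans (by simp [QMat.gen])⟩
  exact hS hφ

/-! ### Comparison of the families -/

namespace Family

variable {k : Type u} [Field k] {q : k} {N : ℕ} [NeZero N]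

/-- The weights of `colLeft` do not depend on the row, which rules out the other kinds with lam =
q², and the position of the weight q identifies the column. -/
theorem eq_colLeft_of_gWeight_eq (hN : 1 < N) (hq0 : q ≠ 0) (hq2 : q ^ 2 ≠ 1) (hq4 : q ^ 4 ≠ 1)
    {b b' : Fin N} {hb : (b' : ℕ) + 1 = b} {f : Family N} (hlam : f.lamValue q = q ^ 2)
    (h : ∀ i j, f.gWeight q i j = (colLeft b b' hb).gWeight q i j) : f = colLeft b b' hb := by
  have h0 := zero_ne_rev_zero hN
  have hl : (q ^ 2)⁻¹ ≠ q ^ 2 := fun e => hq4 (by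
    field_simp at e
    linear_combination -e)
  have hqi : q ≠ q⁻¹ := fun e => hq2 (by
    field_simp at e
    exact e)
  have hq1 : q ≠ 1 := by rintro rfl; simp at hq2
  cases f with
  | colLeft c c' hc =>
    have e := h 0 b'
    simp only [gWeight, if_true] at e
    have hbc : b' = c' := by
      by_contra hne
      rw [if_neg hne] at e
      split_ifs at e
      exacts [hqi e.symm, hq1 e.symm]
    subst hbc
    obtain rfl : b = c := Fin.ext (by omega)
    rfl
  | rowUp c c' hc =>
    have e : (rowUp c c' hc).gWeight q c' 0 = (rowUp c c' hc).gWeight q c 0 :=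
      (h c' 0).trans (h c 0).symm
    have hne : c ≠ c' := by rintro rfl; omega
    simp only [gWeight, if_true, if_neg hne] at e
    exact absurd e hqi
  | firstToTopRight =>
    have e : (firstToTopRight : Family N).gWeight q 0 0 =
      (firstToTopRight : Family N).gWeight q (Fin.rev 0) 0 := (h 0 0).trans (h (Fin.rev 0) 0).symm
    simp only [gWeight, if_true, if_neg h0.symm] at e
    refine absurd ?_ hq2
    field_simp at e
    exact e.symm
  | firstToBottomLeft =>
    have e : (firstToBottomLeft : Family N).gWeight q 0 0 =
      (firstToBottomLeft : Family N).gWeight q (Fin.rev 0) 0 :=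
        (h 0 0).trans (h (Fin.rev 0) 0).symm
    simp only [gWeight, if_true, if_neg h0.symm] at e
    refine absurd ?_ hqi
    exact (mul_left_cancel₀ (inv_ne_zero (pow_ne_zero 2 hq0)) e).symm
  | _ => exact absurd hlam hl

theorem eq_firstToTopRight_of_gWeight_eq (hN : 3 ≤ N) (hq0 : q ≠ 0) (hq2 : q ^ 2 ≠ 1)
    (hq4 : q ^ 4 ≠ 1) {f : Family N} (hlam : f.lamValue q = q ^ 2)
    (h : ∀ i j, f.gWeight q i j = (firstToTopRight : Family N).gWeight q i j) :
    f = firstToTopRight := by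
  have hN1 : 1 < N := by omega
  have h0 := zero_ne_rev_zero hN1
  have hl : (q ^ 2)⁻¹ ≠ q ^ 2 := fun e => hq4 (by
    field_simp at e
    linear_combination -e)
  have hqi : q ≠ q⁻¹ := fun e => hq2 (by
    field_simp at e
    exact e)
  cases f with
  | colLeft c c' hc =>
    exact (eq_colLeft_of_gWeight_eq hN1 hq0 hq2 hq4 rfl fun i j => (h i j).symm).symm
  | rowUp c c' hc =>
    have e : (firstToTopRight : Family N).gWeight q 0 0 =
      (firstToTopRight : Family N).gWeight q 0 (Fin.rev 0) :=
        (h 0 0).symm.trans (h 0 (Fin.rev 0))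
    simp only [gWeight, if_true, if_neg h0.symm] at e
    refine absurd ?_ hqi
    exact (mul_left_cancel₀ (inv_ne_zero (pow_ne_zero 2 hq0)) e).symm
  | firstToTopRight => rfl
  | firstToBottomLeft =>
    have e := h ⟨1, hN1⟩ 0
    have h1 : (⟨1, hN1⟩ : Fin N) ≠ 0 := by
      intro h; simpa using congrArg Fin.val h
    have h2 : (⟨1, hN1⟩ : Fin N) ≠ Fin.rev 0 := by
      intro h
      have := congrArg Fin.val h
      rw [Fin.val_rev, Fin.val_zero] at this
      simp at this
      omega
    simp only [gWeight, if_true, if_neg h1, if_neg h2] at e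
    refine absurd ?_ hq2
    field_simp at e
    rw [← e, one_pow]
  | _ => exact absurd hlam hl

/-- The condition q⁴ ≠ 1 separates the families with lam = q² from those with lam = q⁻². Reversal
and transposition reduce the comparison to `colLeft` and `firstToTopRight`. -/
theorem gWeight_injective (hN : 3 ≤ N) (hq0 : q ≠ 0) (hq2 : q ^ 2 ≠ 1) (hq4 : q ^ 4 ≠ 1)
    {f f' : Family N} (hlam : f.lamValue q = f'.lamValue q)
    (h : ∀ i j, f.gWeight q i j = f'.gWeight q i j) : f = f' := by
  have hN1 : 1 < N := by omega
  have key : ∀ q : k, q ≠ 0 → q ^ 2 ≠ 1 → q ^ 4 ≠ 1 → ∀ f f' : Family N,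
      f'.lamValue q = q ^ 2 → f.lamValue q = f'.lamValue q →
      (∀ i j, f.gWeight q i j = f'.gWeight q i j) → f = f' := by
    intro q hq0 hq2 hq4 f f' hl hlam h
    have hl' : (q ^ 2)⁻¹ ≠ q ^ 2 := fun e => hq4 (by
      field_simp at e
      linear_combination -e)
    have ht : ∀ i j, f.transpose.gWeight q i j = f'.transpose.gWeight q i j := fun i j => by
      rw [gWeight_transpose, gWeight_transpose, h]
    have hlt : f.transpose.lamValue q = q ^ 2 := (f.lamValue_transpose q).trans (hlam.trans hl)
    cases f' with
    | colLeft b b' hb => exact eq_colLeft_of_gWeight_eq hN1 hq0 hq2 hq4 hlam h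
    | firstToTopRight => exact eq_firstToTopRight_of_gWeight_eq hN hq0 hq2 hq4 hlam h
    | rowUp b b' hb =>
      exact transpose_injective (eq_colLeft_of_gWeight_eq hN1 hq0 hq2 hq4 hlt ht)
    | firstToBottomLeft =>
      exact transpose_injective (eq_firstToTopRight_of_gWeight_eq hN hq0 hq2 hq4 hlt ht)
    | _ => exact absurd hl hl'
  have hl : f'.lamValue q = q ^ 2 ∨ f'.rev.lamValue q⁻¹ = q⁻¹ ^ 2 := by
    cases f' <;> simp [rev, lamValue]
  rcases hl with hl | hl
  · exact key q hq0 hq2 hq4 f f' hl hlam h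
  · refine rev_injective (key q⁻¹ (inv_ne_zero hq0) ?_ ?_ _ _ hl ?_ fun i j => ?_)
    · rwa [inv_pow, ne_eq, inv_eq_one]
    · rwa [inv_pow, ne_eq, inv_eq_one]
    · rw [lamValue_rev, lamValue_rev, hlam]
    · rw [gWeight_rev hN1, gWeight_rev hN1, h]

end Family

/-! ### Admissible actions and families -/

section Admissible

variable {k : Type u} [Field k] {q : k} {N n m : ℕ} {lam : k}

theorem QMat.gen_mem_degreeOne (p : Fin N × Fin N) : gen k q N p ∈ degreeOne k q N :=
  Submodule.subset_span ⟨p.1, p.2, rfl⟩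

theorem QMat.exists_of_mem_degreeOne {y : QMat k q N} (hy : y ∈ degreeOne k q N) :
    ∃ c : Fin N × Fin N → k, y = ∑ s, c s • gen k q N s := by
  have h : degreeOne k q N ≤ Submodule.span k (Set.range (gen k q N)) := by
    refine Submodule.span_mono ?_
    rintro _ ⟨i, j, rfl⟩
    exact ⟨(i, j), rfl⟩
  obtain ⟨c, hc⟩ := (Submodule.mem_span_range_iff_exists_fun k).mp (h hy)
  exact ⟨c, hc.symm⟩

theorem QMat.coeff_eq_of_sum_eq {c d : Fin N × Fin N → k}
    (h : ∑ s, c s • gen k q N s = ∑ s, d s • gen k q N s) (s : Fin N × Fin N) : c s = d s := by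
  refine sub_eq_zero.mp (Fintype.linearIndependent_iff.mp (linearIndependent_gen q N)
    (fun s => c s - d s) ?_ s)
  simp only [sub_smul, Finset.sum_sub_distrib, h, sub_self]

theorem sq_ne_one_of_primitiveRoot (hlam : IsPrimitiveRoot lam m) (hm : 3 ≤ m) : lam ^ 2 ≠ 1 :=
  hlam.pow_ne_one_of_pos_of_lt (by omega) (by omega)

variable [NeZero N] [NeZero n] [NeZero m] [Fact (IsPrimitiveRoot lam m)]

theorem isGivenBy_iff {ρ : HopfAction k (Taft k n m lam) (QMat k q N)} {f : Family N} {d : k} :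
    IsGivenBy ρ f d ↔ ∀ p,
      ρ.act (Taft.g k n m lam) (QMat.gen k q N p) = f.gWeight q p.1 p.2 • QMat.gen k q N p ∧
      ρ.act (Taft.x k n m lam) (QMat.gen k q N p) = ∑ s, f.coeff d p s • QMat.gen k q N s := by
  simp only [IsGivenBy, Family.xValue_eq]
  exact ⟨fun h p => h p.1 p.2, fun h i j => h (i, j)⟩

theorem exists_family_of_isAdmissible (hq0 : q ≠ 0) (hq2 : q ^ 2 ≠ 1) (hN : 3 ≤ N) (hm : 3 ≤ m)
    {ρ : HopfAction k (Taft k n m lam) (QMat k q N)} (hρ : IsAdmissible ρ) :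
    ∃ (f : Family N) (d : k), d ≠ 0 ∧ lam = f.lamValue q ∧ IsGivenBy ρ f d := by
  have hlam := sq_ne_one_of_primitiveRoot (lam := lam) (m := m) Fact.out hm
  choose C hC using fun p => QMat.exists_of_mem_degreeOne
    (hρ.x_linear _ (QMat.gen_mem_degreeOne (q := q) p))
  have hne : ∃ p s, C p s ≠ 0 := by
    by_contra! h0
    exact hρ.x_ne_zero (HopfAction.x_eq_zero fun p => by simp [hC, h0])
  obtain ⟨p₀, s₀, h0⟩ := hne
  obtain ⟨φ, hφ, hg⟩ := hρ.g_mem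
  obtain ⟨a, b, h | h⟩ := exists_of_mem_torusTranspose hφ
  · set α : Fin N × Fin N → k := fun p => (a p.1 : k) * b p.2
    have hG : ∀ p, ρ.act (Taft.g k n m lam) (QMat.gen k q N p) = α p • QMat.gen k q N (id p) :=
      fun p => (hg _).trans (h p)
    have hα0 : ∀ p, α p ≠ 0 := fun p => mul_ne_zero (a p.1).ne_zero (b p.2).ne_zero
    have hCα : ∀ p s, C p s ≠ 0 → α s = lam * α p := by
      intro p s hps
      have := ρ.g_x_apply (QMat.gen k q N p)
      rw [hG, id_eq, map_smul, hC, map_sum, smul_smul, Finset.smul_sum] at this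
      simp only [map_smul, hG, smul_smul, id_eq] at this
      have := QMat.coeff_eq_of_sum_eq this s
      exact mul_left_cancel₀ hps (by linear_combination this)
    have hcomp := ρ.compatible hG hC
    have hfit : ∀ p s, C p s ≠ 0 → FitsFamily q lam α C p s := fun p s =>
      fitsFamily_of_ne_zero hN hq0 hq2 hlam (a := fun i => a i) (b := fun j => b j)
        (fun p => rfl) hα0 hCα hcomp
    obtain ⟨f, h1, h2, h3, h4, h5⟩ := hfit p₀ s₀ h0
    refine ⟨f, C p₀ s₀, h0, h1, isGivenBy_iff.mpr fun p => ⟨by rw [hG, h2]; rfl, ?_⟩⟩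
    rw [hC]
    refine Finset.sum_congr rfl fun s _ => ?_
    congr 1
    -- Since lam is q² or q⁻², q⁴ = 1 would give lam² = 1.
    have hq4 : q ^ 4 ≠ 1 := by
      intro h
      refine hlam ?_
      rw [h1]
      have : (q ^ 2) ^ 2 = 1 := by rw [← h]; ring
      cases f <;> simp [Family.lamValue, this]
    by_cases hps : C p s = 0
    · rw [hps, Family.coeff]
      split_ifs with e1 e2
      · rw [← h5 p e2, ← e1, hps]
      · rfl
      · rfl
    -- Every nonzero entry belongs to a family with the same weights and the same lam, hence to f;
    -- so C has no arrows outside f.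
    · obtain ⟨f', h1', h2', h3', h4', -⟩ := hfit p s hps
      obtain rfl : f' = f := Family.gWeight_injective hN hq0 hq2 hq4 (h1'.symm.trans h1)
        fun i j => (h2' (i, j)).symm.trans (h2 (i, j))
      rw [Family.coeff, if_pos h4'.symm, if_pos h3', ← h4', h5 p h3']
  · exfalso
    set α : Fin N × Fin N → k := fun p => (a p.1 : k) * b p.2
    have hG : ∀ p, ρ.act (Taft.g k n m lam) (QMat.gen k q N p) = α p • QMat.gen k q N p.swap :=
      fun p => (hg _).trans (h p)
    have hα0 : ∀ p, α p ≠ 0 := fun p => mul_ne_zero (a p.1).ne_zero (b p.2).ne_zero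
    refine h0 (transposed_eq_zero hN hq0 hlam hα0 (fun p s => ?_) (ρ.compatible hG hC) p₀ s₀)
    have h1 := ρ.g_x_apply (QMat.gen k q N p)
    rw [hG, map_smul, hC, hC, map_sum, smul_smul, Finset.smul_sum] at h1
    simp only [map_smul, hG, smul_smul] at h1
    -- Here g also permutes the generators, so the sum is reindexed before coefficients are
    -- compared.
    have h2 : ∑ s, (C p s * α s) • QMat.gen k q N s.swap =
        ∑ s : Fin N × Fin N, (C p s.swap * α s.swap) • QMat.gen k q N s :=
      Fintype.sum_equiv (Equiv.prodComm (Fin N) (Fin N)) _ _ fun s => by simp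
    rw [h2] at h1
    simpa using QMat.coeff_eq_of_sum_eq h1 s.swap

theorem isAdmissible_of_isGivenBy (hq0 : q ≠ 0)
    {ρ : HopfAction k (Taft k n m lam) (QMat k q N)} {f : Family N} {d : k} (hd : d ≠ 0)
    (h : IsGivenBy ρ f d) : IsAdmissible ρ := by
  rw [isGivenBy_iff] at h
  refine ⟨fun y hy => ?_, fun h0 => ?_, ?_⟩
  · obtain ⟨c, rfl⟩ := QMat.exists_of_mem_degreeOne hy
    rw [map_sum]
    refine Submodule.sum_mem _ fun s _ => ?_
    rw [map_smul, (h s).2]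
    exact Submodule.smul_mem _ _ (Submodule.sum_mem _ fun t _ =>
      Submodule.smul_mem _ _ (QMat.gen_mem_degreeOne t))
  · obtain ⟨p, hp⟩ := f.exists_src
    have := (h p).2
    rw [h0, LinearMap.zero_apply, Family.sum_coeff_smul, if_pos hp] at this
    exact smul_ne_zero hd (QMat.gen_ne_zero q N _) this.symm
  · obtain ⟨a, b, hab⟩ := f.exists_gWeight_eq_mul hq0
    refine ⟨QMat.torusHom k q N (a, b), Subgroup.mem_sup_left ⟨(a, b), rfl⟩, fun y => ?_⟩
    have : ρ.gHom = QMat.scaleHom q a b := QMat.algHom_ext fun i j => by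
      rw [QMat.scaleHom_Y, ← hab]
      exact (h (i, j)).1
    exact AlgHom.congr_fun this y

/-- Some generator is an eigenvector of g with eigenvalue q, and g^n acts as the identity. -/
theorem orderOf_dvd_of_isGivenBy (hN : 3 ≤ N)
    {ρ : HopfAction k (Taft k n m lam) (QMat k q N)} {f : Family N} {d : k}
    (h : IsGivenBy ρ f d) : orderOf q ∣ n := by
  rw [isGivenBy_iff] at h
  obtain ⟨i, j, hij⟩ := f.exists_gWeight_eq hN q
  have hg := (h (i, j)).1
  rw [hij] at hg
  have he : Module.End.HasEigenvector (ρ.act (Taft.g k n m lam)) q (QMat.gen k q N (i, j)) :=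
    ⟨Module.End.mem_eigenspace_iff.mpr hg, QMat.gen_ne_zero q N _⟩
  have hp := he.pow_apply n
  rw [ρ.g_pow_apply] at hp
  rw [orderOf_dvd_iff_pow_eq_one]
  refine smul_left_injective k (QMat.gen_ne_zero q N (i, j)) ?_
  simpa using hp.symm

theorem existsUnique_isGivenBy (hq0 : q ≠ 0) (hN : 1 < N) (hm : 2 ≤ m) (hqn : orderOf q ∣ n)
    {f : Family N} (d : k) (hlam : lam = f.lamValue q) :
    ∃! ρ : HopfAction k (Taft k n m lam) (QMat k q N), IsGivenBy ρ f d := by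
  obtain ⟨a, b, hab⟩ := f.exists_gWeight_eq_mul hq0
  have hsrc : ∀ p s, f.coeff d p s ≠ 0 → s = f.arrow p ∧ f.Src p := by
    intro p s hps
    unfold Family.coeff at hps
    by_contra hne
    split_ifs at hps <;> tauto
  obtain ⟨ρ, hρ⟩ := exists_action_of_compatible (n := n) (lam := lam)
    (f.compatible (M := QMat k q N) hq0 hN d) a b (fun p => hab p.1 p.2)
    (fun p => f.gWeight_pow (orderOf_dvd_iff_pow_eq_one.mp hqn) p.1 p.2)
    (fun p s hps => by
      obtain ⟨rfl, hp⟩ := hsrc p s hps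
      rw [hlam, f.gWeight_arrow hq0 hN p hp])
    (fun p s t => by
      by_contra hne
      obtain ⟨rfl, -⟩ := hsrc p s (left_ne_zero_of_mul hne)
      exact f.arrow_not_src hN p (hsrc _ t (right_ne_zero_of_mul hne)).2) hm
  refine ⟨ρ, isGivenBy_iff.mpr hρ, fun σ hσ => ?_⟩
  have hσ' := isGivenBy_iff.mp hσ
  exact HopfAction.ext_gen (fun p => (hσ' p).1.trans (hρ p).1.symm)
    fun p => (hσ' p).2.trans (hρ p).2.symm

end Admissible

end QuantumMatrixActions

end

/-! ### Assembly of the classification -/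

theorem mainTheorem5 {k : Type*} [Field k] [IsAlgClosed k] [CharZero k]
    (q : k) (hq0 : q ≠ 0) (hq1 : q ≠ 1) (hq2 : q ≠ -1)
    (N n m : ℕ) [NeZero N] [NeZero n] [NeZero m] (hN : 3 ≤ N) (hm : 3 ≤ m) (hmn : m ∣ n)
    (lam : k) [Fact (IsPrimitiveRoot lam m)] :
    ((∃ ρ : QuantumMatrixActions.HopfAction k (QuantumMatrixActions.Taft k n m lam)
          (QuantumMatrixActions.QMat k q N), QuantumMatrixActions.IsAdmissible ρ) ↔
      (lam = q ^ 2 ∨ lam = (q ^ 2)⁻¹) ∧ orderOf q ∣ n) ∧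
    (∀ ρ : QuantumMatrixActions.HopfAction k (QuantumMatrixActions.Taft k n m lam)
          (QuantumMatrixActions.QMat k q N),
      QuantumMatrixActions.IsAdmissible ρ ↔
        ∃ (f : QuantumMatrixActions.Family N) (d : k),
          d ≠ 0 ∧ lam = f.lamValue q ∧ QuantumMatrixActions.IsGivenBy ρ f d) ∧
    (∀ (f : QuantumMatrixActions.Family N) (d : k),
      d ≠ 0 → lam = f.lamValue q → orderOf q ∣ n →
        ∃! ρ : QuantumMatrixActions.HopfAction k (QuantumMatrixActions.Taft k n m lam)
          (QuantumMatrixActions.QMat k q N), QuantumMatrixActions.IsGivenBy ρ f d) := by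
  open QuantumMatrixActions in
  have hqsq : q ^ 2 ≠ 1 := by
    intro h
    rcases sq_eq_one_iff.mp h with h | h
    exacts [hq1 h, hq2 h]
  have hclass : ∀ ρ : HopfAction k (Taft k n m lam) (QMat k q N), IsAdmissible ρ ↔
      ∃ (f : Family N) (d : k), d ≠ 0 ∧ lam = f.lamValue q ∧ IsGivenBy ρ f d := fun ρ =>
    ⟨exists_family_of_isAdmissible hq0 hqsq hN hm,
      fun ⟨_, _, hd, _, h⟩ => isAdmissible_of_isGivenBy hq0 hd h⟩
  have hexists : ∀ (f : Family N) (d : k), d ≠ 0 → lam = f.lamValue q → orderOf q ∣ n →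
      ∃! ρ : HopfAction k (Taft k n m lam) (QMat k q N), IsGivenBy ρ f d :=
    fun f d _ hlam hqn => existsUnique_isGivenBy hq0 (by omega) (by omega) hqn d hlam
  refine ⟨⟨?_, ?_⟩, hclass, hexists⟩
  · rintro ⟨ρ, hρ⟩
    obtain ⟨f, d, -, hlam, hf⟩ := (hclass ρ).mp hρ
    refine ⟨?_, orderOf_dvd_of_isGivenBy hN hf⟩
    cases f <;> simp [hlam, Family.lamValue]
  · rintro ⟨hlam, hqn⟩
    have hf : ∃ f : Family N, lam = f.lamValue q := by
      rcases hlam with hlam | hlam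
      · exact ⟨Family.firstToTopRight, hlam⟩
      · exact ⟨Family.lastToTopRight, hlam⟩
    obtain ⟨f, hf⟩ := hf
    obtain ⟨ρ, hρ, -⟩ := hexists f 1 one_ne_zero hf hqn
    exact ⟨ρ, (hclass ρ).mpr ⟨f, 1, one_ne_zero, hf, hρ⟩⟩
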